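/- Let $\mathcal X=\mathbb R^d$ be the state space, let $T=2$ be the number of periods, let $x^i=(x^i_1,x^i_2)\in\mathcal X^2$, $i=1,\dots,N$, be $N\ge 1$ sample paths, let $\epsilon\ge 0$, and let $g:\{1,2,\infty\}\times\mathcal X^2\to\mathbb R_+$ be a reward function with $g(\infty,\cdot)\equiv 0$. Put $\mathcal U^i_t=\{y\in\mathcal X:\|y-x^i_t\|_\infty\le\epsilon\}$ and $\mathcal U^i=\mathcal U^i_1\times\mathcal U^i_2$. Consider the integer problem $$\text{(IP)}\qquad \max_{\sigma^1,\dots,\sigma^N\in\{1,2\}}\ \frac1N\sum_{i=1}^N\ \min_{t\in\{1,\dots,\sigma^i\}}\bigl\{g(t,x^i):\ \text{there is } j \text{ with } \mathcal U^i_t\cap\mathcal U^j_t\ne\emptyset \text{ and } \sigma^j=t\bigr\}$$ and the robust optimization problem $$\text{(RO)}\qquad \sup_{\mu}\ \frac1N\sum_{i=1}^N\ \inf_{y\in\mathcal U^i} g(\tau_\mu(y),x^i),$$ where $\mu=(\mu_1,\mu_2)$ ranges over pairs of measurable functions $\mu_t:\mathcal X\to\{\text{Stop},\text{Continue}\}$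 and $\tau_\mu(y)=\min\{t\in\{1,2\}:\mu_t(y_t)=\text{Stop}\}$ (with $\min\emptyset=\infty$). For $\sigma=(\sigma^1,\dots,\sigma^N)\in\{1,2\}^N$ let $\mu^\sigma$ be the exercise policies with $\mu^\sigma_t(y_t)=\text{Stop}$ if and only if $y_t\in\bigcup_{i:\sigma^i=t}\mathcal U^i_t$. Running time is the number of elementary steps of a random-access machine with natural-number and real-valued memory cells, in which each memory access, each addition, subtraction or comparison (of natural numbers or of reals), each assignment and each use of a (natural or rational) constant takes one step; a program is a fixed finite text that does not depend on $N$, $d$ or the data. Then (IP), and hence (RO), can be solved exactly in $\mathcal O(N^3)$ time. That is: 1. There are a program and a constant $C$ such that, for all $N$, $d$, $x^1,\dots,x^N$, $\epsilon$ and $g$ as above, the program, given $N$, the rewards $g(t,x^i)$ and the table of the pairs $i,j$ and periods $t$ with $\mathcal U^i_t\cap\mathcal U^j_t\neq\emptyset$, halts after at most $C N^3$ steps and outputs an optimal solution $\sigma$ of (IP) for which $\mu^\sigma$ is an optimal solution of (RO). 2. There are a program and a constant $C$ such that, for all such data, the program, given $N$, $d$, $\epsilon$, the rewards $g(t,x^i)$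 and the sample paths $x^i_t$ (with no precomputed table), halts after at most $C(N^3+N^2d)$ steps with such an output; for fixed $d$ this is $\mathcal O(N^3)$. -/

import Mathlib

/-! ## A random-access machine with real-valued cells

Programs are finite texts of a structured imperative language.  A store has natural-number and
real-valued registers and (infinitely long) natural-number and real-valued arrays, which are
addressed indirectly by natural numbers.  On natural numbers a program may add, subtract
(truncated at zero) and compare; on reals it may add, subtract and compare.  There is no
multiplication, division, rounding or conversion between the two sorts, and program texts contain
only natural and rational constants.  Every constant, memory access, arithmetic operation,
assignment and test costs at least one step. -/

namespace RealRAM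

/-- The store of the machine. -/
structure Store where
  /-- natural-number registers -/
  nreg : ℕ → ℕ
  /-- real registers -/
  rreg : ℕ → ℝ
  /-- `narr a p` is the cell at address `p` of the natural-number array `a` -/
  narr : ℕ → ℕ → ℕ
  /-- `rarr a p` is the cell at address `p` of the real array `a` -/
  rarr : ℕ → ℕ → ℝ

/-- Natural-number expressions. -/
inductive NExp where
  | num (c : ℕ)
  | reg (v : ℕ)
  | get (a : ℕ) (p : NExp)
  | add (e f : NExp)
  | sub (e f : NExp)

/-- The value of a natural-number expression. -/
def NExp.eval (s : Store) : NExp → ℕ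
  | .num c => c
  | .reg v => s.nreg v
  | .get a p => s.narr a (p.eval s)
  | .add e f => e.eval s + f.eval s
  | .sub e f => e.eval s - f.eval s

/-- The number of steps spent on evaluating a natural-number expression: one for each constant,
register access, array access and arithmetic operation in it. -/
def NExp.cost : NExp → ℕ
  | .num _ => 1
  | .reg _ => 1
  | .get _ p => p.cost + 1
  | .add e f => e.cost + f.cost + 1
  | .sub e f => e.cost + f.cost + 1

/-- Real expressions. -/
inductive RExp where
  | num (q : ℚ)
  | reg (v : ℕ)
  | get (a : ℕ) (p : NExp)
  | add (e f : RExp)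
  | sub (e f : RExp)

/-- The value of a real expression. -/
noncomputable def RExp.eval (s : Store) : RExp → ℝ
  | .num q => (q : ℝ)
  | .reg v => s.rreg v
  | .get a p => s.rarr a (p.eval s)
  | .add e f => e.eval s + f.eval s
  | .sub e f => e.eval s - f.eval s

/-- The number of steps spent on evaluating a real expression. -/
def RExp.cost : RExp → ℕ
  | .num _ => 1
  | .reg _ => 1
  | .get _ p => p.cost + 1
  | .add e f => e.cost + f.cost + 1
  | .sub e f => e.cost + f.cost + 1

/-- Tests. -/
inductive Test where
  | nlt (e f : NExp)
  | neq (e f : NExp)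
  | rlt (e f : RExp)
  | req (e f : RExp)
  | not (b : Test)
  | and (b c : Test)

/-- The truth of a test in a store. -/
def Test.holds (s : Store) : Test → Prop
  | .nlt e f => e.eval s < f.eval s
  | .neq e f => e.eval s = f.eval s
  | .rlt e f => e.eval s < f.eval s
  | .req e f => e.eval s = f.eval s
  | .not b => ¬ b.holds s
  | .and b c => b.holds s ∧ c.holds s

/-- The number of steps spent on a test. -/
def Test.cost : Test → ℕ
  | .nlt e f => e.cost + f.cost + 1
  | .neq e f => e.cost + f.cost + 1
  | .rlt e f => e.cost + f.cost + 1
  | .req e f => e.cost + f.cost + 1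
  | .not b => b.cost + 1
  | .and b c => b.cost + c.cost + 1

/-- Programs. -/
inductive Prog where
  | skip
  /-- assign to a natural-number register -/
  | nset (v : ℕ) (e : NExp)
  /-- assign to a real register -/
  | rset (v : ℕ) (e : RExp)
  /-- assign to the cell at address `p` of natural-number array `a` -/
  | nput (a : ℕ) (p : NExp) (e : NExp)
  /-- assign to the cell at address `p` of real array `a` -/
  | rput (a : ℕ) (p : NExp) (e : RExp)
  | seq (P Q : Prog)
  /-- if `b` then `P` else `Q` -/
  | branch (b : Test) (P Q : Prog)
  /-- while `b` do `P` -/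
  | loop (b : Test) (P : Prog)

/-- `Exec P s s' n`: started in the store `s`, the program `P` halts after exactly `n` steps, with
final store `s'`.  (`P` and `s` determine `s'` and `n`.) -/
inductive Exec : Prog → Store → Store → ℕ → Prop where
  | skip (s : Store) : Exec .skip s s 1
  | nset (v : ℕ) (e : NExp) (s : Store) :
      Exec (.nset v e) s { s with nreg := Function.update s.nreg v (e.eval s) } (e.cost + 1)
  | rset (v : ℕ) (e : RExp) (s : Store) :
      Exec (.rset v e) s { s with rreg := Function.update s.rreg v (e.eval s) } (e.cost + 1)
  | nput (a : ℕ) (p e : NExp) (s : Store) :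
      Exec (.nput a p e) s
        { s with narr := Function.update s.narr a
                  (Function.update (s.narr a) (p.eval s) (e.eval s)) }
        (p.cost + e.cost + 1)
  | rput (a : ℕ) (p : NExp) (e : RExp) (s : Store) :
      Exec (.rput a p e) s
        { s with rarr := Function.update s.rarr a
                  (Function.update (s.rarr a) (p.eval s) (e.eval s)) }
        (p.cost + e.cost + 1)
  | seq {P Q : Prog} {s s' s'' : Store} {m n : ℕ} :
      Exec P s s' m → Exec Q s' s'' n → Exec (.seq P Q) s s'' (m + n)
  | branch_true {b : Test} {P Q : Prog} {s s' : Store} {n : ℕ} :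
      b.holds s → Exec P s s' n → Exec (.branch b P Q) s s' (b.cost + n + 1)
  | branch_false {b : Test} {P Q : Prog} {s s' : Store} {n : ℕ} :
      ¬ b.holds s → Exec Q s s' n → Exec (.branch b P Q) s s' (b.cost + n + 1)
  | loop_true {b : Test} {P : Prog} {s s' s'' : Store} {m n : ℕ} :
      b.holds s → Exec P s s' m → Exec (.loop b P) s' s'' n →
      Exec (.loop b P) s s'' (b.cost + m + n + 1)
  | loop_false {b : Test} {P : Prog} {s : Store} :
      ¬ b.holds s → Exec (.loop b P) s s (b.cost + 1)

/-- A vector of length `m` as an array (zero beyond the end). -/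
def vec {α : Type} [Zero α] {m : ℕ} (f : Fin m → α) (p : ℕ) : α :=
  if h : p < m then f ⟨p, h⟩ else 0

/-- An `m × n` matrix as an array in row-major order: the entry `(i, j)` is at address
`i * n + j` (zero beyond the end). -/
def mat {α : Type} [Zero α] {m n : ℕ} (f : Fin m → Fin n → α) (p : ℕ) : α :=
  if h : p < m * n then
    f (finProdFinEquiv.symm ⟨p, h⟩).1 (finProdFinEquiv.symm ⟨p, h⟩).2
  else 0

end RealRAM

/-! ## The robust optimization problem and its integer reformulation

There are `T` periods, `N` sample paths `x i = (x i t)_t` with states in `ℝ^d` (functions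
`Fin d → ℝ`, whose norm is the maximum norm), a robustness parameter `ε` and a reward function `g`
of the stopping period (`⊤` means never) and the path.  Periods and paths are indexed from zero. -/

namespace OptStop

/-- The uncertainty set around sample path `i` on period `t`. -/
def U {T N d : ℕ} (x : Fin N → Fin T → Fin d → ℝ) (ε : ℝ) (i : Fin N) (t : Fin T) :
    Set (Fin d → ℝ) :=
  {y | ‖y - x i t‖ ≤ ε}

/-- The Markovian stopping rule of the exercise policies `μ` (`true` means stop): the first period
at which `μ` stops, or `⊤` if there is none. -/
def stopTime {T d : ℕ} (μ : Fin T → (Fin d → ℝ) → Bool) (y : Fin T → Fin d → ℝ) :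
    WithTop (Fin T) :=
  (Finset.univ.filter fun t => μ t (y t) = true).min

/-- The objective of the robust optimization problem at the exercise policies `μ`. -/
noncomputable def roObj {T N d : ℕ} (g : WithTop (Fin T) → (Fin T → Fin d → ℝ) → ℝ)
    (x : Fin N → Fin T → Fin d → ℝ) (ε : ℝ) (μ : Fin T → (Fin d → ℝ) → Bool) : ℝ :=
  (1 / (N : ℝ)) * ∑ i, ⨅ y : {y : Fin T → Fin d → ℝ // ∀ t, y t ∈ U x ε i t},
    g (stopTime μ y.1) (x i)

/-- `μ` is an optimal solution of the robust optimization problem, which is the maximization of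
`roObj` over all measurable exercise policies. -/
def IsOptimalRO {T N d : ℕ} (g : WithTop (Fin T) → (Fin T → Fin d → ℝ) → ℝ)
    (x : Fin N → Fin T → Fin d → ℝ) (ε : ℝ) (μ : Fin T → (Fin d → ℝ) → Bool) : Prop :=
  (∀ t, Measurable (μ t)) ∧
    ∀ μ' : Fin T → (Fin d → ℝ) → Bool, (∀ t, Measurable (μ' t)) → roObj g x ε μ' ≤ roObj g x ε μ

/-- The exercise policies generated by `σ`: stop at `y` in period `t` if and only if `y` lies in
the period-`t` uncertainty set of some sample path `i` with `σ i = t`. -/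
noncomputable def policy {T N d : ℕ} (x : Fin N → Fin T → Fin d → ℝ) (ε : ℝ)
    (σ : Fin N → Fin T) (t : Fin T) (y : Fin d → ℝ) : Bool :=
  open scoped Classical in decide (∃ i, σ i = t ∧ y ∈ U x ε i t)

/-- The objective of the integer problem at `σ`.  (For `0 ≤ ε` the finite set whose minimum is
taken contains the reward at `t = σ i`, so it is not empty.) -/
noncomputable def ipObj {T N d : ℕ} (g : WithTop (Fin T) → (Fin T → Fin d → ℝ) → ℝ)
    (x : Fin N → Fin T → Fin d → ℝ) (ε : ℝ) (σ : Fin N → Fin T) : ℝ :=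
  (1 / (N : ℝ)) * ∑ i, sInf {r : ℝ | ∃ t : Fin T, t ≤ σ i ∧
    (∃ j, (U x ε i t ∩ U x ε j t).Nonempty ∧ σ j = t) ∧ r = g t (x i)}

/-- `σ` is an optimal solution of the integer problem. -/
def IsOptimalIP {T N d : ℕ} (g : WithTop (Fin T) → (Fin T → Fin d → ℝ) → ℝ)
    (x : Fin N → Fin T → Fin d → ℝ) (ε : ℝ) (σ : Fin N → Fin T) : Prop :=
  ∀ σ' : Fin N → Fin T, ipObj g x ε σ' ≤ ipObj g x ε σ

/-! ### Input and output for two periods -/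

/-- The store that presents an instance of the integer problem with two periods: natural register
`0` holds `N`; for `t = 0, 1` the real array `t` holds the rewards `g t (x i)`, and the natural
array `t` holds the `N × N` table that tells (by `1` and `0`) whether the period-`t` uncertainty
sets of the paths `i` and `j` intersect.  Everything else is zero. -/
noncomputable def tableInput {N d : ℕ} (g : WithTop (Fin 2) → (Fin 2 → Fin d → ℝ) → ℝ)
    (x : Fin N → Fin 2 → Fin d → ℝ) (ε : ℝ) : RealRAM.Store where
  nreg v := if v = 0 then N else 0
  rreg _ := 0
  narr a := if h : a < 2 then
      RealRAM.mat fun i j : Fin N =>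
        open scoped Classical in if (U x ε i ⟨a, h⟩ ∩ U x ε j ⟨a, h⟩).Nonempty then 1 else 0
    else fun _ => 0
  rarr a := if h : a < 2 then
      RealRAM.vec fun i : Fin N => g ((⟨a, h⟩ : Fin 2) : WithTop (Fin 2)) (x i)
    else fun _ => 0

/-- The store that presents the data of the robust optimization problem with two periods: natural
registers `0` and `1` hold `N` and `d`, real register `0` holds `ε`; for `t = 0, 1` the real array
`t` holds the rewards `g t (x i)` and the real array `2 + t` holds the `N × d` matrix of the
states `x i t`.  Everything else is zero. -/
noncomputable def rawInput {N d : ℕ} (g : WithTop (Fin 2) → (Fin 2 → Fin d → ℝ) → ℝ)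
    (x : Fin N → Fin 2 → Fin d → ℝ) (ε : ℝ) : RealRAM.Store where
  nreg v := if v = 0 then N else if v = 1 then d else 0
  rreg v := if v = 0 then ε else 0
  narr _ _ := 0
  rarr a := if h : a < 2 then
      RealRAM.vec fun i : Fin N => g ((⟨a, h⟩ : Fin 2) : WithTop (Fin 2)) (x i)
    else if a = 2 then RealRAM.mat fun (i : Fin N) (k : Fin d) => x i 0 k
    else if a = 3 then RealRAM.mat fun (i : Fin N) (k : Fin d) => x i 1 k
    else fun _ => 0

/-- The program `P`, started in the store `s₀`, halts within `b` steps, and the first `N` cells of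
natural array `2` then hold an optimal solution `σ` of the integer problem whose exercise policies
are an optimal solution of the robust optimization problem. -/
def SolvesWithin {N d : ℕ} (P : RealRAM.Prog) (s₀ : RealRAM.Store) (b : ℕ)
    (g : WithTop (Fin 2) → (Fin 2 → Fin d → ℝ) → ℝ)
    (x : Fin N → Fin 2 → Fin d → ℝ) (ε : ℝ) : Prop :=
  ∃ (s : RealRAM.Store) (n : ℕ), RealRAM.Exec P s₀ s n ∧ n ≤ b ∧
    ∃ σ : Fin N → Fin 2, (∀ i : Fin N, s.narr 2 (i : ℕ) = (σ i : ℕ)) ∧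
      IsOptimalIP g x ε σ ∧ IsOptimalRO g x ε (policy x ε σ)

end OptStop

/-! ## Reasoning about programs -/

namespace RealRAM

/-- Started in `s`, the program `P` halts within `b` steps in a store that satisfies `Q`. -/
def Runs (P : Prog) (s : Store) (b : ℕ) (Q : Store → Prop) : Prop :=
  ∃ (s' : Store) (n : ℕ), Exec P s s' n ∧ n ≤ b ∧ Q s'

theorem Runs.mono {P : Prog} {s : Store} {b b' : ℕ} {Q Q' : Store → Prop}
    (h : Runs P s b Q) (hb : b ≤ b') (hQ : ∀ s, Q s → Q' s) : Runs P s b' Q' := by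
  obtain ⟨s', n, he, hn, hq⟩ := h
  exact ⟨s', n, he, hn.trans hb, hQ _ hq⟩

theorem Runs.seq {P P' : Prog} {s : Store} {b b' : ℕ} {R Q : Store → Prop}
    (h : Runs P s b R) (h' : ∀ s, R s → Runs P' s b' Q) : Runs (.seq P P') s (b + b') Q := by
  obtain ⟨s', n, he, hn, hq⟩ := h
  obtain ⟨s'', n', he', hn', hq'⟩ := h' s' hq
  exact ⟨s'', n + n', .seq he he', add_le_add hn hn', hq'⟩

/-- `Ψ` bounds the iterations left; each is charged `t.cost + K + 1`, and the last summand pays for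
the failing test. -/
theorem Runs.loop {t : Test} {P : Prog} (I : Store → Prop) (Ψ : Store → ℕ) (K : ℕ)
    (hbody : ∀ s, I s → t.holds s → Runs P s K fun s' => I s' ∧ Ψ s' < Ψ s) {s : Store}
    (hs : I s) :
    Runs (.loop t P) s ((t.cost + K + 1) * Ψ s + (t.cost + 1)) fun s' => I s' ∧ ¬ t.holds s' := by
  induction hm : Ψ s using Nat.strong_induction_on generalizing s with
  | _ m ih =>
    subst hm
    by_cases ht : t.holds s
    · obtain ⟨s', n, he, hn, hI, hlt⟩ := hbody s hs ht
      obtain ⟨s'', n', he', hn', hq⟩ := ih _ hlt hI rfl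
      refine ⟨s'', _, .loop_true ht he he', ?_, hq⟩
      have : (t.cost + K + 1) * (Ψ s' + 1) ≤ (t.cost + K + 1) * Ψ s := Nat.mul_le_mul_left _ hlt
      rw [mul_add] at this
      omega
    · exact ⟨s, _, .loop_false ht, by omega, hs, ht⟩

/-- The weakest precondition of a loop-free program. -/
def wp : Prog → (Store → Prop) → Store → Prop
  | .skip, Q, s => Q s
  | .nset v e, Q, s => Q { s with nreg := Function.update s.nreg v (e.eval s) }
  | .rset v e, Q, s => Q { s with rreg := Function.update s.rreg v (e.eval s) }
  | .nput a p e, Q, s => Q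
      { s with narr := Function.update s.narr a
                (Function.update (s.narr a) (p.eval s) (e.eval s)) }
  | .rput a p e, Q, s => Q
      { s with rarr := Function.update s.rarr a
                (Function.update (s.rarr a) (p.eval s) (e.eval s)) }
  | .seq P P', Q, s => wp P (wp P' Q) s
  | .branch t P P', Q, s => (t.holds s → wp P Q s) ∧ (¬ t.holds s → wp P' Q s)
  | .loop _ _, _, _ => False

/-- A bound on the number of steps of a loop-free program. -/
def Prog.bound : Prog → ℕ
  | .skip => 1
  | .nset _ e => e.cost + 1
  | .rset _ e => e.cost + 1
  | .nput _ p e => p.cost + e.cost + 1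
  | .rput _ p e => p.cost + e.cost + 1
  | .seq P P' => P.bound + P'.bound
  | .branch t P P' => t.cost + (P.bound + P'.bound) + 1
  | .loop _ _ => 0

/-- The bound charges a branch for both sides, so it depends on the text alone and `decide` can
evaluate it. -/
theorem Runs.of_wp {P : Prog} {Q : Store → Prop} {s : Store} (h : wp P Q s) :
    Runs P s P.bound Q := by
  induction P generalizing Q s with
  | skip => exact ⟨_, _, .skip s, le_rfl, h⟩
  | nset v e => exact ⟨_, _, .nset v e s, le_rfl, h⟩
  | rset v e => exact ⟨_, _, .rset v e s, le_rfl, h⟩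
  | nput a p e => exact ⟨_, _, .nput a p e s, le_rfl, h⟩
  | rput a p e => exact ⟨_, _, .rput a p e s, le_rfl, h⟩
  | seq P P' ih ih' => exact (ih h).seq fun s hs => ih' hs
  | branch t P P' ih ih' =>
    by_cases ht : t.holds s
    · obtain ⟨s', n, he, hn, hq⟩ := ih (h.1 ht)
      exact ⟨s', _, .branch_true ht he, by simp only [Prog.bound]; omega, hq⟩
    · obtain ⟨s', n, he, hn, hq⟩ := ih' (h.2 ht)
      exact ⟨s', _, .branch_false ht he, by simp only [Prog.bound]; omega, hq⟩
  | loop t P => exact h.elim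

end RealRAM

/-! ## A push-relabel method for the maximum-weight closure problem

The arcs are given by a relation `D` on `{0, …, N - 1}` and have infinite capacity; node `i` has
weight `b i`.  The method maintains a flow `F` on the arcs, the excess `e` of every node (a node
of negative excess acts as a sink), heights `h` and current arcs `cur`.  The nodes are scanned
cyclically; `u` is the position of the scan and `B` bounds the heights of the active nodes. -/

namespace Closure

/-- `(i, j)` is a residual arc of the flow `F`. -/
def Residual (D : ℕ → ℕ → Prop) (F : ℕ → ℕ → ℝ) (i j : ℕ) : Prop := D i j ∨ 0 < F j i

/-- The invariant of the push-relabel method. -/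
structure Inv (N : ℕ) (D : ℕ → ℕ → Prop) (b : ℕ → ℝ) (u B : ℕ) (h cur : ℕ → ℕ) (e : ℕ → ℝ)
    (F : ℕ → ℕ → ℝ) : Prop where
  pos_le : u ≤ N
  height_le : ∀ i < N, h i ≤ N
  cur_le : ∀ i < N, cur i ≤ N
  flow_nonneg : ∀ i < N, ∀ j < N, 0 ≤ F i j
  flow_arc : ∀ i < N, ∀ j < N, ¬ D i j → F i j = 0
  excess_eq : ∀ i < N,
    e i = b i - ∑ j ∈ Finset.range N, F i j + ∑ j ∈ Finset.range N, F j i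
  deficit : ∀ i < N, e i < 0 → h i = 0
  valid : ∀ i < N, ∀ j < N, Residual D F i j → h i ≤ h j + 1
  scanned : ∀ i < N, ∀ j < cur i, Residual D F i j → h i ≠ h j + 1
  active_ge : ∀ i < N, u ≤ i → 0 < e i → h i < N → h i < B
  active_lt : ∀ i < u, 0 < e i → h i < N → h i + 1 < B

/-- A bound on the number of remaining steps of the push-relabel method. -/
def potential (N u B : ℕ) (h cur : ℕ → ℕ) : ℕ :=
  (2 * N + 2) * ∑ i ∈ Finset.range N, (N - h i) + B * (N + 1) + (N - u) +
    ∑ i ∈ Finset.range N, (N - cur i)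

theorem sum_sub_update (N u m : ℕ) (h : ℕ → ℕ) (hu : u < N) :
    ∑ i ∈ Finset.range N, (N - Function.update h u m i) + (N - h u) =
      ∑ i ∈ Finset.range N, (N - h i) + (N - m) := by
  rw [← Finset.add_sum_erase _ _ (Finset.mem_range.2 hu),
    ← Finset.add_sum_erase (Finset.range N) (fun i => N - h i) (Finset.mem_range.2 hu)]
  have : ∑ i ∈ (Finset.range N).erase u, (N - Function.update h u m i) =
      ∑ i ∈ (Finset.range N).erase u, (N - h i) :=
    Finset.sum_congr rfl fun i hi => by
      rw [Function.update_of_ne (Finset.ne_of_mem_erase hi)]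
  simp only [this, Function.update_self]
  omega

section

variable {N : ℕ} {D : ℕ → ℕ → Prop} {b : ℕ → ℝ} {u B : ℕ} {h cur : ℕ → ℕ} {e : ℕ → ℝ}
  {F : ℕ → ℕ → ℝ}

/-! ### Preservation of the push-relabel invariant -/

theorem Inv.init (N : ℕ) (D : ℕ → ℕ → Prop) (b : ℕ → ℝ) :
    Inv N D b 0 1 (fun _ => 0) (fun _ => 0) b (fun _ _ => 0) := by
  constructor <;> simp

theorem Inv.congr {e' : ℕ → ℝ} {F' : ℕ → ℕ → ℝ} (H : Inv N D b u B h cur e F)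
    (he : ∀ i < N, e' i = e i) (hF : ∀ i < N, ∀ j < N, F' i j = F i j) :
    Inv N D b u B h cur e' F' where
  pos_le := H.pos_le
  height_le := H.height_le
  cur_le := H.cur_le
  flow_nonneg i hi j hj := by rw [hF i hi j hj]; exact H.flow_nonneg i hi j hj
  flow_arc i hi j hj := by rw [hF i hi j hj]; exact H.flow_arc i hi j hj
  excess_eq i hi := by
    rw [he i hi, H.excess_eq i hi]
    congr 1
    · congr 1
      exact Finset.sum_congr rfl fun j hj => (hF i hi j (Finset.mem_range.1 hj)).symm
    · exact Finset.sum_congr rfl fun j hj => (hF j (Finset.mem_range.1 hj) i hi).symm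
  deficit i hi := by rw [he i hi]; exact H.deficit i hi
  valid i hi j hj := by
    unfold Residual; rw [hF j hj i hi]; exact H.valid i hi j hj
  scanned i hi j hj := by
    unfold Residual
    rw [hF j (hj.trans_le (H.cur_le i hi)) i hi]; exact H.scanned i hi j hj
  active_ge i hi := by rw [he i hi]; exact H.active_ge i hi
  active_lt i hi := by rw [he i (hi.trans_le H.pos_le)]; exact H.active_lt i hi

/-- At the end of a pass every node is behind the scan, where active heights are below `B - 1`. -/
theorem Inv.nextPass (H : Inv N D b N B h cur e F) : Inv N D b 0 (B - 1) h cur e F where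
  __ := H
  pos_le := Nat.zero_le _
  active_ge i hi _ h1 h2 := by have := H.active_lt i hi h1 h2; omega
  active_lt i hi := by omega

theorem Inv.nextNode (H : Inv N D b u B h cur e F) (hu : u < N) (hi : ¬ (0 < e u ∧ h u < N)) :
    Inv N D b (u + 1) B h cur e F where
  __ := H
  pos_le := hu
  active_ge i hi h0 h1 h2 := H.active_ge i hi (by omega) h1 h2
  active_lt i h0 h1 h2 := by
    rcases eq_or_ne i u with rfl | hne
    · exact absurd ⟨h1, h2⟩ hi
    · exact H.active_lt i (by omega) h1 h2

/-- When all arcs have been scanned, no residual arc out of `u` leads down, so raising `u` by one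
keeps the labelling valid. Arcs into `u` dropped by at most one level, so none of them leads down
afterwards. -/
theorem Inv.relabel (H : Inv N D b u B h cur e F) (hu : u < N) (he : 0 < e u) (hh : h u < N)
    (hc : cur u = N) :
    Inv N D b u (B + 1) (Function.update h u (h u + 1)) (Function.update cur u 0) e F where
  __ := H
  height_le i hi := by
    rcases eq_or_ne i u with rfl | hne
    · simpa using hh
    · simpa [hne] using H.height_le i hi
  cur_le i hi := by
    rcases eq_or_ne i u with rfl | hne
    · simp
    · simpa [hne] using H.cur_le i hi
  deficit i hi h0 := by
    rcases eq_or_ne i u with rfl | hne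
    · exact absurd h0 he.le.not_gt
    · simpa [hne] using H.deficit i hi h0
  valid i hi j hj hr := by
    have h1 := H.valid i hi j hj hr
    rcases eq_or_ne i u with rfl | hne
    · have h2 := H.scanned i hi j (by omega) hr
      rcases eq_or_ne j i with rfl | hne'
      · simp
      · simp [hne']; omega
    · rcases eq_or_ne j u with rfl | hne'
      · simp [hne]; omega
      · simpa [hne, hne'] using h1
  scanned i hi j hj hr := by
    rcases eq_or_ne i u with rfl | hne
    · simp at hj
    · rw [Function.update_of_ne hne] at hj ⊢
      have h1 := H.valid i hi j (hj.trans_le (H.cur_le i hi)) hr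
      rcases eq_or_ne j u with rfl | hne'
      · simp; omega
      · simpa [hne'] using H.scanned i hi j hj hr
  active_ge i hi h0 h1 h2 := by
    rcases eq_or_ne i u with rfl | hne
    · simpa using H.active_ge i hi h0 he hh
    · rw [Function.update_of_ne hne] at h2 ⊢
      have := H.active_ge i hi h0 h1 h2; omega
  active_lt i h0 h1 h2 := by
    rw [Function.update_of_ne (by omega)] at h2 ⊢
    have := H.active_lt i h0 h1 h2; omega

theorem Inv.nextArc (H : Inv N D b u B h cur e F) (hu : u < N) (hc : cur u < N)
    (ha : Residual D F u (cur u) → h u ≠ h (cur u) + 1) :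
    Inv N D b u B h (Function.update cur u (cur u + 1)) e F where
  __ := H
  cur_le i hi := by
    rcases eq_or_ne i u with rfl | hne
    · simpa using hc
    · simpa [hne] using H.cur_le i hi
  scanned i hi j hj hr := by
    rcases eq_or_ne i u with rfl | hne
    · rw [Function.update_self] at hj
      rcases eq_or_ne j (cur i) with rfl | hne'
      · exact ha hr
      · exact H.scanned i hi j (by omega) hr
    · rw [Function.update_of_ne hne] at hj
      exact H.scanned i hi j hj hr

/-- Changing the flow on the arc `(p, q)` by `δ`. -/
theorem excess_update {p q : ℕ} (hp : p < N) (hq : q < N) (hpq : p ≠ q) (δ : ℝ)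
    {e' : ℕ → ℝ} {F' : ℕ → ℕ → ℝ}
    (hF : ∀ i < N, ∀ j < N, F' i j = F i j + if i = p ∧ j = q then δ else 0)
    (he : ∀ i < N, e' i = if i = p then e i - δ else if i = q then e i + δ else e i)
    (H : ∀ i < N, e i = b i - ∑ j ∈ Finset.range N, F i j + ∑ j ∈ Finset.range N, F j i) :
    ∀ i < N, e' i = b i - ∑ j ∈ Finset.range N, F' i j + ∑ j ∈ Finset.range N, F' j i := by
  intro i hi
  have h1 : ∑ j ∈ Finset.range N, F' i j =
      ∑ j ∈ Finset.range N, F i j + if i = p then δ else 0 := by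
    rw [Finset.sum_congr rfl fun j hj => hF i hi j (Finset.mem_range.1 hj),
      Finset.sum_add_distrib]
    by_cases hip : i = p <;> simp [hip, hq]
  have h2 : ∑ j ∈ Finset.range N, F' j i =
      ∑ j ∈ Finset.range N, F j i + if i = q then δ else 0 := by
    rw [Finset.sum_congr rfl fun j hj => hF j (Finset.mem_range.1 hj) i hi,
      Finset.sum_add_distrib]
    by_cases hip : i = q <;> simp [hip, hp]
  rw [h1, h2, he i hi, H i hi]
  by_cases hip : i = p
  · have : i ≠ q := hip ▸ hpq
    simp [hip, hpq]; ring
  · by_cases hiq : i = q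
    · simp [hiq]; rw [if_neg (Ne.symm hpq), if_neg (Ne.symm hpq)]; ring
    · simp [hip, hiq]

/-- Pushing the amount `δ` from the scanned node `u` down to `v` keeps the invariant. -/
theorem Inv.push (H : Inv N D b u B h cur e F) {v : ℕ} (hu : u < N) (hv : v < N)
    (he : 0 < e u) (hN : h u < N) (hh : h u = h v + 1) {δ : ℝ} (h0 : 0 < δ) (h1 : δ ≤ e u)
    {e' : ℕ → ℝ} {F' : ℕ → ℕ → ℝ}
    (he' : ∀ i < N, e' i = if i = u then e i - δ else if i = v then e i + δ else e i)
    (hF' : (D u v ∧ ∀ i < N, ∀ j < N, F' i j = F i j + if i = u ∧ j = v then δ else 0) ∨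
      (δ ≤ F v u ∧ ∀ i < N, ∀ j < N, F' i j = F i j + if i = v ∧ j = u then -δ else 0)) :
    Inv N D b u B h cur e' F' := by
  have huv : u ≠ v := by rintro rfl; omega
  -- The only residual arc that a push can create is `(v, u)`. It leads upward, so it violates
  -- neither `valid` nor `scanned`.
  have hres : ∀ i < N, ∀ j < N, Residual D F' i j → Residual D F i j ∨ i = v ∧ j = u := by
    intro i hi j hj hr
    rcases hr with hr | hr
    · exact .inl (.inl hr)
    · by_cases hij : i = v ∧ j = u
      · exact .inr hij
      · left; right
        rcases hF' with ⟨-, hF⟩ | ⟨-, hF⟩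
        · rw [hF j hj i hi, if_neg (by tauto)] at hr; simpa using hr
        · rw [hF j hj i hi] at hr
          split_ifs at hr <;> linarith
  refine ⟨H.pos_le, H.height_le, H.cur_le, ?_, ?_, ?_, ?_, ?_, ?_, ?_, ?_⟩
  · intro i hi j hj
    have := H.flow_nonneg i hi j hj
    rcases hF' with ⟨-, hF⟩ | ⟨hle, hF⟩
    · rw [hF i hi j hj]; split_ifs <;> linarith
    · rw [hF i hi j hj]; split_ifs with hij
      · obtain ⟨rfl, rfl⟩ := hij; linarith
      · linarith
  · intro i hi j hj hD
    have := H.flow_arc i hi j hj hD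
    rcases hF' with ⟨hD', hF⟩ | ⟨hle, hF⟩
    · rw [hF i hi j hj, this, if_neg]
      · simp
      · rintro ⟨rfl, rfl⟩; exact hD hD'
    · rw [hF i hi j hj, this, if_neg]
      · simp
      · rintro ⟨rfl, rfl⟩; linarith
  · rcases hF' with ⟨-, hF⟩ | ⟨-, hF⟩
    · exact excess_update hu hv huv δ hF he' H.excess_eq
    · refine excess_update hv hu huv.symm (-δ) hF (fun i hi => ?_) H.excess_eq
      rw [he' i hi]
      by_cases hiu : i = u
      · simp [hiu, huv, sub_eq_add_neg]
      · by_cases hiv : i = v <;> simp [hiu, hiv]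
        intro hvu; exact absurd hvu.symm huv
  · intro i hi hneg
    rw [he' i hi] at hneg
    split_ifs at hneg with hiu hiv
    · subst hiu; linarith
    · exact H.deficit i hi (by linarith)
    · exact H.deficit i hi hneg
  · intro i hi j hj hr
    rcases hres i hi j hj hr with hr | ⟨rfl, rfl⟩
    · exact H.valid i hi j hj hr
    · omega
  · intro i hi j hj hr
    rcases hres i hi j (hj.trans_le (H.cur_le i hi)) hr with hr | ⟨rfl, rfl⟩
    · exact H.scanned i hi j hj hr
    · omega
  · intro i hi hui hpos hlt
    have hB := H.active_ge u hu le_rfl he hN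
    rw [he' i hi] at hpos
    split_ifs at hpos with hiu hiv
    · rw [hiu]; exact hB
    · rw [hiv]; omega
    · exact H.active_ge i hi hui hpos hlt
  -- A node behind the scan can become active again only as the head `v`, at height `h u - 1` with
  -- `h u < B`.
  · intro i hui hpos hlt
    have hB := H.active_ge u hu le_rfl he hN
    rw [he' i (hui.trans hu)] at hpos
    split_ifs at hpos with hiu hiv
    · omega
    · rw [hiv]; omega
    · exact H.active_lt i hui hpos hlt

/-! ### Decrease of the potential -/

theorem potential_nextPass (hB : 0 < B) : potential N 0 (B - 1) h cur < potential N N B h cur := by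
  obtain ⟨B, rfl⟩ := Nat.exists_eq_add_of_le' hB
  simp only [potential, Nat.add_sub_cancel, Nat.sub_self, Nat.sub_zero, add_mul]
  omega

theorem potential_nextNode (hu : u < N) :
    potential N (u + 1) B h cur < potential N u B h cur := by
  simp only [potential]; omega

theorem potential_nextArc (hu : u < N) (hc : cur u < N) :
    potential N u B h (Function.update cur u (cur u + 1)) < potential N u B h cur := by
  have := sum_sub_update N u (cur u + 1) cur hu
  simp only [potential]; omega

/-- The weights are forced: a new pass resets the scan at the price `N`, so `B` has weight `N + 1`;
a relabel raises `B` and resets a current arc at the price `(N + 1) + N`, so a height has weight `2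
* N + 2`. -/
theorem potential_relabel (hu : u < N) (hh : h u < N) (hc : cur u = N) :
    potential N u (B + 1) (Function.update h u (h u + 1)) (Function.update cur u 0) <
      potential N u B h cur := by
  have h1 := sum_sub_update N u 0 cur hu
  have h2 := sum_sub_update N u (h u + 1) h hu
  have h3 : ∑ i ∈ Finset.range N, (N - h i) =
      ∑ i ∈ Finset.range N, (N - Function.update h u (h u + 1) i) + 1 := by omega
  rw [hc] at h1
  simp only [potential, h3, mul_add, add_mul]
  omega

theorem potential_init_le (hN : 1 ≤ N) :
    potential N 0 1 (fun _ => 0) (fun _ => 0) ≤ 8 * N ^ 3 := by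
  simp only [potential, Nat.sub_zero, Finset.sum_const, Finset.card_range, smul_eq_mul]
  have h1 : N ≤ N ^ 3 := Nat.le_self_pow (by norm_num) N
  have h2 : N ^ 2 ≤ N ^ 3 := Nat.pow_le_pow_right hN (by norm_num)
  nlinarith

/-! ### Duality and the optimality of the set above a gap -/

/-- Weak duality: the weight of a closed set is at most the excess in it. -/
theorem weight_le (H : Inv N D b u B h cur e F) {S : Finset ℕ} (hS : S ⊆ Finset.range N)
    (hc : ∀ i ∈ S, ∀ j < N, D i j → j ∈ S) : ∑ i ∈ S, b i ≤ ∑ i ∈ S, e i := by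
  -- Flow runs along arcs only, so none leaves a closed set; flow may still enter it, whence the
  -- inequality.
  have h1 : ∀ i ∈ S, ∑ j ∈ Finset.range N, F i j = ∑ j ∈ S, F i j := fun i hi =>
    (Finset.sum_subset hS fun j hj hjS => H.flow_arc i (Finset.mem_range.1 (hS hi)) j
      (Finset.mem_range.1 hj) fun hD => hjS (hc i hi j (Finset.mem_range.1 hj) hD)).symm
  have h2 : ∀ i ∈ S, ∑ j ∈ S, F j i ≤ ∑ j ∈ Finset.range N, F j i := fun i hi =>
    Finset.sum_le_sum_of_subset_of_nonneg hS fun j hj _ =>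
      H.flow_nonneg j (Finset.mem_range.1 hj) i (Finset.mem_range.1 (hS hi))
  have h3 : ∑ i ∈ S, e i = ∑ i ∈ S, b i - ∑ i ∈ S, ∑ j ∈ S, F i j +
      ∑ i ∈ S, ∑ j ∈ Finset.range N, F j i := by
    rw [Finset.sum_congr rfl fun i hi => H.excess_eq i (Finset.mem_range.1 (hS hi)),
      Finset.sum_add_distrib, Finset.sum_sub_distrib, Finset.sum_congr rfl h1]
  have h4 : ∑ i ∈ S, ∑ j ∈ S, F j i ≤ ∑ i ∈ S, ∑ j ∈ Finset.range N, F j i :=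
    Finset.sum_le_sum h2
  have h5 : ∑ i ∈ S, ∑ j ∈ S, F i j = ∑ i ∈ S, ∑ j ∈ S, F j i := Finset.sum_comm
  linarith

/-- The nodes above a gap in the heights. -/
def above (N : ℕ) (h : ℕ → ℕ) (k : ℕ) : Finset ℕ := (Finset.range N).filter fun i => k < h i

/-- An arc descends by at most one level, so it cannot jump over the empty level `k`. -/
theorem above_closed (H : Inv N D b u B h cur e F) {k : ℕ} (hk : ∀ i < N, h i ≠ k) :
    ∀ i ∈ above N h k, ∀ j < N, D i j → j ∈ above N h k := by
  intro i hi j hj hD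
  simp only [above, Finset.mem_filter, Finset.mem_range] at hi ⊢
  have := H.valid i hi.1 j hj (.inl hD)
  have := hk j hj
  exact ⟨hj, by omega⟩

/-- Flow entering from below the gap would give a residual arc that descends by at least two levels.
So no flow crosses the boundary in either direction, and weak duality is tight. -/
theorem weight_above (H : Inv N D b u B h cur e F) {k : ℕ} (hk : ∀ i < N, h i ≠ k) :
    ∑ i ∈ above N h k, b i = ∑ i ∈ above N h k, e i := by
  set S := above N h k with hSdef
  have hS : S ⊆ Finset.range N := Finset.filter_subset _ _
  have hc := above_closed H hk
  have h1 : ∀ i ∈ S, ∑ j ∈ Finset.range N, F i j = ∑ j ∈ S, F i j := fun i hi =>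
    (Finset.sum_subset hS fun j hj hjS => H.flow_arc i (Finset.mem_range.1 (hS hi)) j
      (Finset.mem_range.1 hj) fun hD => hjS (hc i hi j (Finset.mem_range.1 hj) hD)).symm
  have h2 : ∀ i ∈ S, ∑ j ∈ Finset.range N, F j i = ∑ j ∈ S, F j i := fun i hi =>
    (Finset.sum_subset hS fun j hj hjS => by
      have hiN := Finset.mem_range.1 (hS hi)
      have hjN := Finset.mem_range.1 hj
      by_contra hne
      have hpos := lt_of_le_of_ne (H.flow_nonneg j hjN i hiN) (Ne.symm hne)
      have := H.valid i hiN j hjN (.inr hpos)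
      have := hk j hjN
      simp only [hSdef, above, Finset.mem_filter, Finset.mem_range] at hi hjS
      omega).symm
  rw [Finset.sum_congr rfl fun i hi => H.excess_eq i (Finset.mem_range.1 (hS hi)),
    Finset.sum_add_distrib, Finset.sum_sub_distrib, Finset.sum_congr rfl h1,
    Finset.sum_congr rfl h2, Finset.sum_comm]
  ring

/-- When no node is active, the nodes above a gap form a closed set of maximum weight. -/
theorem weight_le_above (H : Inv N D b u 0 h cur e F) {k : ℕ} (hkN : k ≤ N)
    (hk : ∀ i < N, h i ≠ k) {S : Finset ℕ} (hS : S ⊆ Finset.range N)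
    (hc : ∀ i ∈ S, ∀ j < N, D i j → j ∈ S) : ∑ i ∈ S, b i ≤ ∑ i ∈ above N h k, b i := by
  rw [weight_above H hk]
  refine (weight_le H hS hc).trans ?_
  have hA : ∀ i < N, i ∈ above N h k → 0 ≤ e i := fun i hi hm => by
    by_contra! hlt
    have := H.deficit i hi hlt
    simp only [above, Finset.mem_filter] at hm
    omega
  -- With `B = 0` nothing is active, so positive excess forces height at least `N ≥ k`, hence above
  -- the gap.
  have hB : ∀ i < N, i ∉ above N h k → e i ≤ 0 := fun i hi hm => by
    by_contra! hlt
    simp only [above, Finset.mem_filter, Finset.mem_range, not_and] at hm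
    have h1 := hm hi
    have h2 := hk i hi
    rcases lt_or_ge i u with hu | hu
    · have := H.active_lt i hu hlt (by omega); omega
    · have := H.active_ge i hi hu hlt (by omega); omega
  calc ∑ i ∈ S, e i ≤ ∑ i ∈ S ∩ above N h k, e i := by
        rw [← Finset.sum_inter_add_sum_sdiff S (above N h k)]
        have : ∑ i ∈ S \ above N h k, e i ≤ 0 := Finset.sum_nonpos fun i hi => by
          rw [Finset.mem_sdiff] at hi
          exact hB i (Finset.mem_range.1 (hS hi.1)) hi.2
        linarith
    _ ≤ _ := Finset.sum_le_sum_of_subset_of_nonneg Finset.inter_subset_right fun i hi _ =>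
        hA i (Finset.mem_range.1 (Finset.mem_of_mem_filter i hi)) hi

/-- Pigeonhole: `N` nodes cannot occupy the `N + 1` levels `0, …, N`. -/
theorem exists_gap (N : ℕ) (h : ℕ → ℕ) : ∃ k ≤ N, ∀ i < N, h i ≠ k := by
  by_contra! hcon
  have : Finset.range (N + 1) ⊆ (Finset.range N).image h := fun k hk => by
    obtain ⟨i, hi, rfl⟩ := hcon k (Nat.lt_succ_iff.1 (Finset.mem_range.1 hk))
    exact Finset.mem_image_of_mem _ (Finset.mem_range.2 hi)
  have := (Finset.card_le_card this).trans Finset.card_image_le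
  simp at this

end

end Closure

/-! ## The push-relabel method as a program

Natural registers: `0` the number of nodes, `2` the position of the scan, `3` the bound on the
heights of the active nodes, `4` and `5` scratch.  Natural arrays: `0` the adjacency table, `2` the
output, `3` the heights, `4` the current arcs, `5` the row offsets, `6` marks of occupied heights.
Real arrays: `0` and `1` the rewards, `4` the flow, `5` the excesses. -/

namespace Closure

open RealRAM

/-- The arcs of the closure problem: from a node that prefers the first period to its neighbours
that prefer the second one. -/
def arc (N : ℕ) (A : ℕ → ℕ) (r₀ r₁ : ℕ → ℝ) (i j : ℕ) : Prop :=
  A (i * N + j) = 1 ∧ ¬ r₀ i < r₁ i ∧ r₀ j < r₁ j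

/-- Row-major addresses do not collide, so a write to the flow array changes a single arc. -/
theorem address_inj {N i j k l : ℕ} (hj : j < N) (hl : l < N) :
    i * N + j = k * N + l ↔ i = k ∧ j = l := by
  constructor
  · intro h
    have h1 : (i * N + j) / N = i := by
      rw [mul_comm, Nat.mul_add_div (by omega), Nat.div_eq_of_lt hj, add_zero]
    have h2 : (k * N + l) / N = k := by
      rw [mul_comm, Nat.mul_add_div (by omega), Nat.div_eq_of_lt hl, add_zero]
    have h3 : i = k := by rw [← h1, h, h2]
    subst h3
    exact ⟨rfl, by omega⟩
  · rintro ⟨rfl, rfl⟩; rfl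

/-! ### Initialization -/

/-- One step of the initialization: excess and row offset of one node. -/
def initBody : Prog :=
  .seq (.rput 5 (.reg 4) (.sub (.get 0 (.reg 4)) (.get 1 (.reg 4))))
    (.seq (.nput 5 (.reg 4) (.reg 5))
      (.seq (.nset 5 (.add (.reg 5) (.reg 0))) (.nset 4 (.add (.reg 4) (.num 1)))))

/-- The initialization. -/
def initProg : Prog :=
  .seq (.seq (.nset 4 (.num 0)) (.nset 5 (.num 0)))
    (.seq (.loop (.nlt (.reg 4) (.reg 0)) initBody)
      (.seq (.nset 2 (.num 0)) (.nset 3 (.num 1))))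

/-- The data of the program: number of nodes, adjacency table and rewards. -/
structure Data (N : ℕ) (A : ℕ → ℕ) (r₀ r₁ : ℕ → ℝ) (s : Store) : Prop where
  size : s.nreg 0 = N
  table : s.narr 0 = A
  reward₀ : s.rarr 0 = r₀
  reward₁ : s.rarr 1 = r₁

/-- The stores from which the program may be started. -/
structure Start (N : ℕ) (A : ℕ → ℕ) (r₀ r₁ : ℕ → ℝ) (s : Store) : Prop
    extends Data N A r₀ r₁ s where
  height : s.narr 3 = fun _ => 0
  cur : s.narr 4 = fun _ => 0
  mark : s.narr 6 = fun _ => 0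
  flow : s.rarr 4 = fun _ => 0

/-- The stores that occur in the main loop. -/
structure Main (N : ℕ) (A : ℕ → ℕ) (r₀ r₁ : ℕ → ℝ) (s : Store) : Prop
    extends Data N A r₀ r₁ s where
  offset : ∀ i < N, s.narr 5 i = i * N
  mark : s.narr 6 = fun _ => 0
  inv : Inv N (arc N A r₀ r₁) (fun i => r₀ i - r₁ i) (s.nreg 2) (s.nreg 3) (s.narr 3) (s.narr 4)
    (s.rarr 5) (fun i j => s.rarr 4 (i * N + j))

section

variable {N : ℕ} {A : ℕ → ℕ} {r₀ r₁ : ℕ → ℝ}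

/-- The machine cannot multiply, so the row offsets `i * N` are accumulated by addition and stored
for constant-time addressing. -/
theorem runs_initProg {s : Store} (hs : Start N A r₀ r₁ s) :
    Runs initProg s (40 * N + 40) fun s =>
      Main N A r₀ r₁ s ∧ s.nreg 2 = 0 ∧ s.nreg 3 = 1 ∧ s.narr 3 = (fun _ => 0) ∧
        s.narr 4 = fun _ => 0 := by
  let I : Store → Prop := fun s => Start N A r₀ r₁ s ∧ s.nreg 4 ≤ N ∧ s.nreg 5 = s.nreg 4 * N ∧
    (∀ i < s.nreg 4, s.narr 5 i = i * N) ∧ ∀ i < s.nreg 4, s.rarr 5 i = r₀ i - r₁ i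
  have h1 : Runs (.seq (.nset 4 (.num 0)) (.nset 5 (.num 0))) s 4 fun s => I s ∧ s.nreg 4 = 0 := by
    refine Runs.of_wp (P := .seq _ _) ?_
    obtain ⟨⟨h1, h2, h3, h4⟩, h5, h6, h7, h8⟩ := hs
    simp only [wp, NExp.eval, I]
    refine ⟨⟨⟨⟨?_, h2, h3, h4⟩, h5, h6, h7, h8⟩, ?_⟩, ?_⟩ <;> simp [h1]
  have h2 : ∀ s, I s ∧ s.nreg 4 = 0 → Runs (.loop (.nlt (.reg 4) (.reg 0)) initBody) s
      (22 * N + 4) fun s => I s ∧ s.nreg 4 = N := by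
    intro s hs
    refine (Runs.loop I (fun s => N - s.nreg 4) initBody.bound ?_ hs.1).mono ?_ ?_
    · rintro s ⟨⟨⟨h1, h2, h3, h4⟩, h5, h6, h7, h8⟩, h9, h10, h11, h12⟩ ht
      refine Runs.of_wp ?_
      simp only [Test.holds, NExp.eval, h1] at ht
      simp only [wp, initBody, NExp.eval, RExp.eval, I]
      refine ⟨⟨⟨⟨?_, ?_, ?_, ?_⟩, ?_, ?_, ?_, ?_⟩, ?_, ?_, ?_, ?_⟩, ?_⟩ <;>
        simp [h1, h2, h3, h4, h5, h6, h7, h8, h10]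
      · exact ht
      · ring
      · intro i hi
        rcases eq_or_ne i (s.nreg 4) with rfl | hne
        · simp
        · simpa [hne] using h11 i (by omega)
      · intro i hi
        rcases eq_or_ne i (s.nreg 4) with rfl | hne
        · simp
        · simpa [hne] using h12 i (by omega)
      · omega
    · simp [Test.cost, NExp.cost, Prog.bound, initBody, RExp.cost, hs.2]
    · rintro s ⟨hI, ht⟩
      refine ⟨hI, ?_⟩
      simp only [Test.holds, NExp.eval, hI.1.size] at ht
      exact le_antisymm hI.2.1 (not_lt.1 ht)
  have h3 : ∀ s, I s ∧ s.nreg 4 = N → Runs (.seq (.nset 2 (.num 0)) (.nset 3 (.num 1))) s 4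
      fun s => Main N A r₀ r₁ s ∧ s.nreg 2 = 0 ∧ s.nreg 3 = 1 ∧ s.narr 3 = (fun _ => 0) ∧
        s.narr 4 = fun _ => 0 := by
    rintro s ⟨⟨⟨⟨h1, h2, h3, h4⟩, h5, h6, h7, h8⟩, h9, h10, h11, h12⟩, h13⟩
    refine Runs.of_wp (P := .seq _ _) ?_
    simp only [wp, NExp.eval]
    rw [h13] at h11 h12
    refine ⟨⟨⟨?_, h2, h3, h4⟩, h11, h7, ?_⟩, ?_, ?_, h5, h6⟩ <;> simp [h1, h5, h6, h8]
    -- The excess array has been filled only at the indices below `N`, which are all that the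
    -- invariant reads.
    exact (Inv.init N _ _).congr h12 (fun _ _ _ _ => rfl)
  exact (h1.seq fun s hs => (h2 s hs).seq h3).mono (by omega) fun s hs => hs

/-! ### The main loop -/

/-- The address of the flow on the current arc of the scanned node. -/
def fwdAddr : NExp := .add (.get 5 (.reg 2)) (.reg 4)

/-- The address of the reverse of the current arc of the scanned node. -/
def bwdAddr : NExp := .add (.get 5 (.reg 4)) (.reg 2)

/-- Scan the next node. -/
def nextNode : Prog := .nset 2 (.add (.reg 2) (.num 1))

/-- Scan the next arc. -/
def nextArc : Prog := .nput 4 (.reg 2) (.add (.reg 4) (.num 1))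

/-- The current arc leads down from the scanned node. -/
def downTest : Test := .neq (.get 3 (.reg 2)) (.add (.get 3 (.reg 4)) (.num 1))

/-- The current arc is an arc of the closure problem. -/
def arcTest : Test :=
  .and (.neq (.get 0 fwdAddr) (.num 1))
    (.and (.not (.rlt (.get 0 (.reg 2)) (.get 1 (.reg 2))))
      (.rlt (.get 0 (.reg 4)) (.get 1 (.reg 4))))

/-- Push along an arc of the closure problem. -/
def pushProg : Prog :=
  .seq (.rput 4 fwdAddr (.add (.get 4 fwdAddr) (.get 5 (.reg 2))))
    (.seq (.rput 5 (.reg 4) (.add (.get 5 (.reg 4)) (.get 5 (.reg 2))))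
      (.rput 5 (.reg 2) (.num 0)))

/-- Send back a part of the flow into the scanned node. -/
def returnProg : Prog :=
  .seq (.rput 4 bwdAddr (.sub (.get 4 bwdAddr) (.get 5 (.reg 2))))
    (.seq (.rput 5 (.reg 4) (.add (.get 5 (.reg 4)) (.get 5 (.reg 2))))
      (.rput 5 (.reg 2) (.num 0)))

/-- Send back the whole flow on an arc into the scanned node. -/
def cancelProg : Prog :=
  .seq (.rput 5 (.reg 2) (.sub (.get 5 (.reg 2)) (.get 4 bwdAddr)))
    (.seq (.rput 5 (.reg 4) (.add (.get 5 (.reg 4)) (.get 4 bwdAddr)))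
      (.rput 4 bwdAddr (.num 0)))

/-- The treatment of the current arc, whose head is in register `4`. -/
def arcProg : Prog :=
  .branch downTest
    (.branch arcTest (.seq pushProg nextNode)
      (.branch (.rlt (.num 0) (.get 4 bwdAddr))
        (.branch (.rlt (.get 4 bwdAddr) (.get 5 (.reg 2)))
          (.seq cancelProg nextArc)
          (.seq returnProg nextNode))
        nextArc))
    nextArc

/-- Relabel the scanned node. -/
def relabelProg : Prog :=
  .seq (.nput 3 (.reg 2) (.add (.get 3 (.reg 2)) (.num 1)))
    (.seq (.nput 4 (.reg 2) (.num 0)) (.nset 3 (.add (.reg 3) (.num 1))))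

/-- One step of the main loop. -/
def mainBody : Prog :=
  .branch (.neq (.reg 2) (.reg 0))
    (.seq (.nset 2 (.num 0)) (.nset 3 (.sub (.reg 3) (.num 1))))
    (.branch
      (.not (.and (.rlt (.num 0) (.get 5 (.reg 2))) (.nlt (.get 3 (.reg 2)) (.reg 0))))
      nextNode
      (.branch (.neq (.get 4 (.reg 2)) (.reg 0)) relabelProg
        (.seq (.nset 4 (.get 4 (.reg 2))) arcProg)))

/-- The potential of a store. -/
def storePotential (N : ℕ) (s : Store) : ℕ :=
  potential N (s.nreg 2) (s.nreg 3) (s.narr 3) (s.narr 4)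

theorem wp_nextArc {s : Store} (hs : Main N A r₀ r₁ s) (hu : s.nreg 2 < N)
    (hv : s.nreg 4 = s.narr 4 (s.nreg 2)) (hv' : s.nreg 4 < N)
    (ha : Residual (arc N A r₀ r₁) (fun i j => s.rarr 4 (i * N + j)) (s.nreg 2) (s.nreg 4) →
      s.narr 3 (s.nreg 2) ≠ s.narr 3 (s.nreg 4) + 1) :
    wp nextArc (fun s' => Main N A r₀ r₁ s' ∧ storePotential N s' < storePotential N s) s := by
  obtain ⟨⟨h1, h2, h3, h4⟩, h5, h6, h7⟩ := hs
  simp only [wp, nextArc, NExp.eval, hv, storePotential] at *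
  refine ⟨⟨⟨h1, ?_, h3, h4⟩, ?_, ?_, ?_⟩, ?_⟩
  · simpa using h2
  · simpa using h5
  · simpa using h6
  · simpa using h7.nextArc hu hv' ha
  · simpa using potential_nextArc hu hv'

theorem wp_nextNode {s : Store} (hs : Main N A r₀ r₁ s) (hu : s.nreg 2 < N)
    (hi : ¬ (0 < s.rarr 5 (s.nreg 2) ∧ s.narr 3 (s.nreg 2) < N)) :
    wp nextNode (fun s' => Main N A r₀ r₁ s' ∧ storePotential N s' < storePotential N s) s := by
  obtain ⟨⟨h1, h2, h3, h4⟩, h5, h6, h7⟩ := hs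
  simp only [wp, nextNode, NExp.eval, storePotential]
  refine ⟨⟨⟨?_, h2, h3, h4⟩, h5, h6, ?_⟩, ?_⟩
  · simpa using h1
  · simpa using h7.nextNode hu hi
  · simpa using potential_nextNode hu

/-- The stores in which the scanned node `u` is active and its current arc leads down. -/
structure Down (N : ℕ) (A : ℕ → ℕ) (r₀ r₁ : ℕ → ℝ) (s : Store) : Prop
    extends Main N A r₀ r₁ s where
  pos_lt : s.nreg 2 < N
  head_lt : s.nreg 4 < N
  active : 0 < s.rarr 5 (s.nreg 2)
  height_lt : s.narr 3 (s.nreg 2) < N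
  down : s.narr 3 (s.nreg 2) = s.narr 3 (s.nreg 4) + 1

theorem Down.ne {s : Store} (hs : Down N A r₀ r₁ s) : s.nreg 4 ≠ s.nreg 2 := by
  intro h
  have := hs.down
  rw [h] at this
  omega

/-- With no capacity to respect, the whole excess moves. The scanned node becomes inactive and the
scan may leave it. -/
theorem wp_pushProg {s : Store} (hs : Down N A r₀ r₁ s)
    (ha : arc N A r₀ r₁ (s.nreg 2) (s.nreg 4)) :
    wp pushProg (fun s' => Main N A r₀ r₁ s' ∧ s'.nreg = s.nreg ∧ s'.narr = s.narr ∧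
      s'.rarr 5 (s.nreg 2) = 0) s := by
  have hne := hs.ne
  obtain ⟨⟨⟨h1, h2, h3, h4⟩, h5, h6, h7⟩, hu, hv, he, hN, hh⟩ := hs
  simp only [wp, pushProg, NExp.eval, RExp.eval, fwdAddr]
  refine ⟨⟨⟨h1, h2, ?_, ?_⟩, h5, h6, ?_⟩, trivial, trivial, ?_⟩
  · simpa using h3
  · simpa using h4
  · refine h7.push hu hv he hN hh he le_rfl ?_ (.inl ⟨ha, ?_⟩)
    · intro i _
      rcases eq_or_ne i (s.nreg 2) with rfl | hi
      · simp
      · rcases eq_or_ne i (s.nreg 4) with rfl | hi' <;> simp [*]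
    · intro i _ j hj
      simp only [h5 _ hu]
      by_cases hij : i = s.nreg 2 ∧ j = s.nreg 4
      · simp [hij]
      · have := mt (address_inj hj hv).1 hij
        simp [hij, this]
  · simp

theorem wp_returnProg {s : Store} (hs : Down N A r₀ r₁ s)
    (ha : s.rarr 5 (s.nreg 2) ≤ s.rarr 4 (s.nreg 4 * N + s.nreg 2)) :
    wp returnProg (fun s' => Main N A r₀ r₁ s' ∧ s'.nreg = s.nreg ∧ s'.narr = s.narr ∧
      s'.rarr 5 (s.nreg 2) = 0) s := by
  have hne := hs.ne
  obtain ⟨⟨⟨h1, h2, h3, h4⟩, h5, h6, h7⟩, hu, hv, he, hN, hh⟩ := hs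
  simp only [wp, returnProg, NExp.eval, RExp.eval, bwdAddr]
  refine ⟨⟨⟨h1, h2, ?_, ?_⟩, h5, h6, ?_⟩, trivial, trivial, ?_⟩
  · simpa using h3
  · simpa using h4
  · refine h7.push hu hv he hN hh he le_rfl ?_ (.inr ⟨ha, ?_⟩)
    · intro i _
      rcases eq_or_ne i (s.nreg 2) with rfl | hi
      · simp
      · rcases eq_or_ne i (s.nreg 4) with rfl | hi' <;> simp [*]
    · intro i _ j hj
      simp only [h5 _ hv]
      by_cases hij : i = s.nreg 4 ∧ j = s.nreg 2
      · simp [hij, sub_eq_add_neg]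
      · have := mt (address_inj hj hu).1 hij
        simp [hij, this]
  · simp

theorem wp_cancelProg {s : Store} (hs : Down N A r₀ r₁ s)
    (h0 : 0 < s.rarr 4 (s.nreg 4 * N + s.nreg 2))
    (ha : s.rarr 4 (s.nreg 4 * N + s.nreg 2) ≤ s.rarr 5 (s.nreg 2)) :
    wp cancelProg (fun s' => Main N A r₀ r₁ s' ∧ s'.nreg = s.nreg ∧ s'.narr = s.narr ∧
      s'.rarr 4 (s.nreg 4 * N + s.nreg 2) = 0) s := by
  have hne := hs.ne
  obtain ⟨⟨⟨h1, h2, h3, h4⟩, h5, h6, h7⟩, hu, hv, he, hN, hh⟩ := hs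
  simp only [wp, cancelProg, NExp.eval, RExp.eval, bwdAddr]
  refine ⟨⟨⟨h1, h2, ?_, ?_⟩, h5, h6, ?_⟩, trivial, trivial, ?_⟩
  · simpa using h3
  · simpa using h4
  · refine h7.push hu hv he hN hh h0 ha ?_ (.inr ⟨le_rfl, ?_⟩)
    · intro i _
      rcases eq_or_ne i (s.nreg 2) with rfl | hi
      · simp [h5 _ hv, hne.symm]
      · rcases eq_or_ne i (s.nreg 4) with rfl | hi' <;> simp [*]
    · intro i _ j hj
      simp only [h5 _ hv]
      by_cases hij : i = s.nreg 4 ∧ j = s.nreg 2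
      · simp [hij]
      · have := mt (address_inj hj hu).1 hij
        simp [hij, this]
  · simp [h5 _ hv]

theorem wp_mono {P : Prog} {R Q : Store → Prop} (h' : ∀ s, R s → Q s) {s : Store}
    (h : wp P R s) : wp P Q s := by
  induction P generalizing R Q s with
  | skip => exact h' _ h
  | nset => exact h' _ h
  | rset => exact h' _ h
  | nput => exact h' _ h
  | rput => exact h' _ h
  | seq P₁ P₂ ih₁ ih₂ => exact ih₁ (fun s hs => ih₂ h' hs) h
  | branch t P₁ P₂ ih₁ ih₂ => exact ⟨fun ht => ih₁ h' (h.1 ht), fun ht => ih₂ h' (h.2 ht)⟩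
  | loop => exact h

theorem wp_seq_mono {P P' : Prog} {R Q : Store → Prop} {s : Store} (h : wp P R s)
    (h' : ∀ s, R s → wp P' Q s) : wp (.seq P P') Q s :=
  wp_mono h' h

/-- Pushing itself leaves the potential unchanged; the drop comes from what follows it. An emptied
node lets the scan advance, and an arc that is not residual or does not lead down lets the current
arc advance. -/
theorem wp_arcProg {s : Store} (hs : Main N A r₀ r₁ s) (hu : s.nreg 2 < N)
    (hv : s.nreg 4 = s.narr 4 (s.nreg 2)) (hv' : s.nreg 4 < N) (he : 0 < s.rarr 5 (s.nreg 2))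
    (hh : s.narr 3 (s.nreg 2) < N) :
    wp arcProg (fun s' => Main N A r₀ r₁ s' ∧ storePotential N s' < storePotential N s) s := by
  refine ⟨fun hd => ?_, fun hd => wp_nextArc hs hu hv hv' fun _ => hd⟩
  have hD : Down N A r₀ r₁ s := ⟨hs, hu, hv', he, hh, hd⟩
  have harc : arcTest.holds s ↔ arc N A r₀ r₁ (s.nreg 2) (s.nreg 4) := by
    simp only [arcTest, Test.holds, NExp.eval, RExp.eval, fwdAddr, arc, hs.offset _ hu, hs.table,
      hs.reward₀, hs.reward₁]
  refine ⟨fun ha => ?_, fun ha => ⟨fun hf => ⟨fun hlt => ?_, fun hlt => ?_⟩, fun hf => ?_⟩⟩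
  · refine wp_seq_mono (wp_pushProg hD (harc.1 ha)) fun s' ⟨h1, h2, h3, h4⟩ => ?_
    have : storePotential N s = storePotential N s' := by simp only [storePotential, h2, h3]
    rw [this]
    exact wp_nextNode h1 (by rwa [h2]) (by rw [h2, h4]; simp)
  · simp only [Test.holds, RExp.eval, NExp.eval, bwdAddr, hs.offset _ hv', Rat.cast_zero] at hf hlt
    refine wp_seq_mono (wp_cancelProg hD hf hlt.le) fun s' ⟨h1, h2, h3, h4⟩ => ?_
    have : storePotential N s = storePotential N s' := by simp only [storePotential, h2, h3]
    rw [this]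
    refine wp_nextArc h1 (by rwa [h2]) (by rw [h2, h3]; exact hv) (by rwa [h2]) ?_
    rw [h2]
    -- After a full cancellation the pair is not residual: it is no arc, and the reverse flow is
    -- zero.
    rintro (h | h)
    · exact absurd (harc.2 h) ha
    · simp [h4] at h
  · simp only [Test.holds, RExp.eval, NExp.eval, bwdAddr, hs.offset _ hv', not_lt] at hlt
    refine wp_seq_mono (wp_returnProg hD hlt) fun s' ⟨h1, h2, h3, h4⟩ => ?_
    have : storePotential N s = storePotential N s' := by simp only [storePotential, h2, h3]
    rw [this]
    exact wp_nextNode h1 (by rwa [h2]) (by rw [h2, h4]; simp)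
  · simp only [Test.holds, RExp.eval, NExp.eval, bwdAddr, hs.offset _ hv', Rat.cast_zero] at hf
    refine wp_nextArc hs hu hv hv' ?_
    rintro (h | h)
    · exact absurd (harc.2 h) ha
    · exact absurd h hf

theorem runs_mainBody {s : Store} (hs : Main N A r₀ r₁ s) (hB : 0 < s.nreg 3) :
    Runs mainBody s mainBody.bound fun s' =>
      Main N A r₀ r₁ s' ∧ storePotential N s' < storePotential N s := by
  refine Runs.of_wp ⟨fun hu => ?_, fun hu => ⟨fun ha => ?_, fun ha =>
    ⟨fun hc => ?_, fun hc => ?_⟩⟩⟩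
  · obtain ⟨⟨h1, h2, h3, h4⟩, h5, h6, h7⟩ := hs
    simp only [Test.holds, NExp.eval, h1] at hu
    simp only [wp, NExp.eval, storePotential]
    rw [hu] at h7
    refine ⟨⟨⟨?_, h2, h3, h4⟩, h5, h6, ?_⟩, ?_⟩
    · simpa using h1
    · simpa using h7.nextPass
    · simpa [hu] using potential_nextPass hB
  · simp only [Test.holds, NExp.eval, RExp.eval, hs.size, Rat.cast_zero] at hu ha
    exact wp_nextNode hs (lt_of_le_of_ne hs.inv.pos_le hu) ha
  · obtain ⟨⟨h1, h2, h3, h4⟩, h5, h6, h7⟩ := hs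
    simp only [Test.holds, NExp.eval, RExp.eval, h1, Rat.cast_zero, not_not] at hu ha hc
    have hu' := lt_of_le_of_ne h7.pos_le hu
    simp only [wp, relabelProg, NExp.eval, storePotential]
    refine ⟨⟨⟨?_, ?_, h3, h4⟩, ?_, ?_, ?_⟩, ?_⟩
    · simpa using h1
    · simpa using h2
    · simpa using h5
    · simpa using h6
    · simpa using h7.relabel hu' ha.1 ha.2 hc
    · simpa using potential_relabel hu' ha.2 hc
  · have hpos : s.nreg 2 < N := lt_of_le_of_ne hs.inv.pos_le (by
      simpa only [Test.holds, NExp.eval, hs.size] using hu)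
    simp only [Test.holds, NExp.eval, RExp.eval, hs.size, Rat.cast_zero, not_not] at ha hc
    have hcur : s.narr 4 (s.nreg 2) < N := lt_of_le_of_ne (hs.inv.cur_le _ hpos) hc
    have hpot : storePotential N s = storePotential N
        { s with nreg := Function.update s.nreg 4 (s.narr 4 (s.nreg 2)) } := by
      simp [storePotential]
    rw [hpot]
    have hs' : Main N A r₀ r₁
        { s with nreg := Function.update s.nreg 4 (s.narr 4 (s.nreg 2)) } := by
      obtain ⟨⟨h1, h2, h3, h4⟩, h5, h6, h7⟩ := hs
      exact ⟨⟨by simpa using h1, h2, h3, h4⟩, h5, h6, by simpa using h7⟩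
    change wp arcProg _ { s with nreg := Function.update s.nreg 4 (s.narr 4 (s.nreg 2)) }
    have h2 : ({ s with nreg := Function.update s.nreg 4 (s.narr 4 (s.nreg 2)) } : Store).nreg 2 =
      s.nreg 2 := by simp
    have h4 : ({ s with nreg := Function.update s.nreg 4 (s.narr 4 (s.nreg 2)) } : Store).nreg 4 =
      s.narr 4 (s.nreg 2) := by simp
    refine wp_arcProg hs' (by rw [h2]; exact hpos) (by rw [h2, h4]) (by rw [h4]; exact hcur) ?_ ?_
    · rw [h2]; exact ha.1
    · rw [h2]; exact ha.2

/-- The main loop. -/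
def mainLoop : Prog := .loop (.nlt (.num 0) (.reg 3)) mainBody

theorem runs_mainLoop {s : Store} (hN : 1 ≤ N) (hs : Main N A r₀ r₁ s) (hu : s.nreg 2 = 0)
    (hB : s.nreg 3 = 1) (hh : s.narr 3 = fun _ => 0) (hc : s.narr 4 = fun _ => 0) :
    Runs mainLoop s (4000 * N ^ 3 + 4) fun s' => Main N A r₀ r₁ s' ∧ s'.nreg 3 = 0 := by
  refine (Runs.loop (Main N A r₀ r₁) (storePotential N) mainBody.bound (fun s hs ht =>
    runs_mainBody hs (by simpa only [Test.holds, NExp.eval] using ht)) hs).mono ?_ ?_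
  · have h1 := potential_init_le hN
    -- At most `8 * N ^ 3` iterations of at most `3 + 400 + 1` steps each stay below `4000 * N ^ 3`.
    have h2 : mainBody.bound ≤ 400 := by decide
    have h3 : storePotential N s ≤ 8 * N ^ 3 := by simpa only [storePotential, hu, hB, hh, hc]
    simp only [Test.cost, NExp.cost]
    nlinarith [Nat.zero_le (N ^ 3), mul_le_mul h2 h3 (Nat.zero_le _) (Nat.zero_le _)]
  · rintro s ⟨hI, ht⟩
    refine ⟨hI, ?_⟩
    simpa only [Test.holds, NExp.eval, not_lt, Nat.le_zero] using ht

/-! ### The output -/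

/-- Mark the height of one node as occupied. -/
def markBody : Prog :=
  .seq (.nput 6 (.get 3 (.reg 4)) (.num 1)) (.nset 4 (.add (.reg 4) (.num 1)))

/-- Write the output for one node. -/
def outBody : Prog :=
  .seq (.branch (.and (.nlt (.reg 5) (.get 3 (.reg 4)))
      (.not (.rlt (.get 0 (.reg 4)) (.get 1 (.reg 4)))))
    (.nput 2 (.reg 4) (.num 0)) (.nput 2 (.reg 4) (.num 1)))
    (.nset 4 (.add (.reg 4) (.num 1)))

/-- Find a gap in the heights and write the output. -/
def finishProg : Prog :=
  .seq (.nset 4 (.num 0))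
    (.seq (.loop (.nlt (.reg 4) (.reg 0)) markBody)
      (.seq (.nset 5 (.num 0))
        (.seq (.loop (.neq (.get 6 (.reg 5)) (.num 1)) (.nset 5 (.add (.reg 5) (.num 1))))
          (.seq (.nset 4 (.num 0))
            (.loop (.nlt (.reg 4) (.reg 0)) outBody)))))

theorem runs_finishProg {s : Store} (hs : Main N A r₀ r₁ s) :
    Runs finishProg s (80 * N + 80) fun s' => ∃ k ≤ N, (∀ i < N, s.narr 3 i ≠ k) ∧
      ∀ i < N, s'.narr 2 i = if k < s.narr 3 i ∧ ¬ r₀ i < r₁ i then 0 else 1 := by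
  -- `K` only guarantees that the search ends by `K`; the gap `k` found by the program may be
  -- smaller.
  obtain ⟨K, hK, hgap⟩ := exists_gap N (s.narr 3)
  let I₀ : Store → Prop := fun s' => Data N A r₀ r₁ s' ∧ s'.narr 3 = s.narr 3
  let I : Store → Prop := fun s' => I₀ s' ∧ s'.nreg 4 ≤ N ∧
    ∀ m, s'.narr 6 m = 1 ↔ ∃ i < s'.nreg 4, s.narr 3 i = m
  let J : Store → Prop := fun s' => I₀ s' ∧ s'.nreg 5 ≤ K ∧
    ∀ m, s'.narr 6 m = 1 ↔ ∃ i < N, s.narr 3 i = m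
  let L : ℕ → Store → Prop := fun k s' => I₀ s' ∧ s'.nreg 5 = k ∧ s'.nreg 4 ≤ N ∧
    ∀ i < s'.nreg 4, s'.narr 2 i = if k < s.narr 3 i ∧ ¬ r₀ i < r₁ i then 0 else 1
  have h1 : Runs (.nset 4 (.num 0)) s 2 fun s => I s ∧ s.nreg 4 = 0 := by
    refine Runs.of_wp (P := .nset _ _) ?_
    obtain ⟨⟨h1, h2, h3, h4⟩, h5, h6, h7⟩ := hs
    simp only [wp, NExp.eval, I, I₀]
    refine ⟨⟨⟨⟨?_, h2, h3, h4⟩, ?_⟩, ?_, ?_⟩, ?_⟩ <;> simp [h1, h6]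
  have h2 : ∀ s', I s' ∧ s'.nreg 4 = 0 → Runs (.loop (.nlt (.reg 4) (.reg 0)) markBody) s'
      (12 * N + 4) fun s' => I s' ∧ s'.nreg 4 = N := by
    intro s' hs'
    refine (Runs.loop I (fun s' => N - s'.nreg 4) markBody.bound ?_ hs'.1).mono ?_ ?_
    · rintro s' ⟨⟨⟨h1, h2, h3, h4⟩, h5⟩, h6, h7⟩ ht
      refine Runs.of_wp ?_
      simp only [Test.holds, NExp.eval, h1] at ht
      simp only [wp, markBody, NExp.eval, I, I₀]
      refine ⟨⟨⟨⟨?_, ?_, ?_, ?_⟩, ?_⟩, ?_, ?_⟩, ?_⟩ <;> simp [h1, h2, h3, h4, h5]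
      · exact ht
      · intro m
        rcases eq_or_ne m (s.narr 3 (s'.nreg 4)) with rfl | hne
        · simp only [Function.update_self, true_iff]
          exact ⟨_, le_rfl, rfl⟩
        · rw [Function.update_of_ne hne, h7]
          constructor
          · rintro ⟨i, hi, rfl⟩; exact ⟨i, by omega, rfl⟩
          · rintro ⟨i, hi, rfl⟩
            refine ⟨i, lt_of_le_of_ne hi ?_, rfl⟩
            rintro rfl; exact hne rfl
      · omega
    · simp only [hs'.2]
      have : markBody.bound = 8 := by decide
      simp only [this, Test.cost, NExp.cost]; omega
    · rintro s' ⟨hI, ht⟩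
      refine ⟨hI, ?_⟩
      simp only [Test.holds, NExp.eval, hI.1.1.size] at ht
      exact le_antisymm hI.2.1 (not_lt.1 ht)
  have h3 : ∀ s', I s' ∧ s'.nreg 4 = N → Runs (.nset 5 (.num 0)) s' 2 fun s' => J s' := by
    rintro s' ⟨⟨⟨⟨h1, h2, h3, h4⟩, h5⟩, h6, h7⟩, h8⟩
    refine Runs.of_wp (P := .nset _ _) ?_
    simp only [wp, NExp.eval, J, I₀]
    rw [h8] at h7
    refine ⟨⟨⟨?_, h2, h3, h4⟩, h5⟩, ?_, h7⟩ <;> simp [h1]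
  have h4 : ∀ s', J s' → Runs
      (.loop (.neq (.get 6 (.reg 5)) (.num 1)) (.nset 5 (.add (.reg 5) (.num 1)))) s'
      (12 * N + 5) fun s' => ∃ k ≤ N, (∀ i < N, s.narr 3 i ≠ k) ∧ I₀ s' ∧ s'.nreg 5 = k := by
    intro s' hs'
    refine (Runs.loop J (fun s' => K - s'.nreg 5) 4 ?_ hs').mono ?_ ?_
    · rintro s' ⟨⟨⟨h1, h2, h3, h4⟩, h5⟩, h6, h7⟩ ht
      refine Runs.of_wp (P := .nset _ _) ?_
      simp only [Test.holds, NExp.eval, h7] at ht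
      have hlt : s'.nreg 5 < K := lt_of_le_of_ne h6 fun h => by
        obtain ⟨i, hi, he⟩ := ht
        exact hgap i hi (he.trans h)
      simp only [wp, NExp.eval, J, I₀]
      refine ⟨⟨⟨⟨?_, h2, h3, h4⟩, h5⟩, ?_, h7⟩, ?_⟩ <;> simp [h1] <;> omega
    · simp only [Test.cost, NExp.cost]; omega
    · rintro s' ⟨⟨h5, h6, h7⟩, ht⟩
      simp only [Test.holds, NExp.eval, h7, not_exists, not_and] at ht
      exact ⟨_, h6.trans hK, ht, h5, rfl⟩
  have h5 : ∀ s', (∃ k ≤ N, (∀ i < N, s.narr 3 i ≠ k) ∧ I₀ s' ∧ s'.nreg 5 = k) →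
      Runs (.nset 4 (.num 0)) s' 2 fun s' => ∃ k ≤ N, (∀ i < N, s.narr 3 i ≠ k) ∧ L k s' ∧
        s'.nreg 4 = 0 := by
    rintro s' ⟨k, hk, hk', ⟨⟨h1, h2, h3, h4⟩, h5⟩, h6⟩
    refine Runs.of_wp (P := .nset _ _) ?_
    simp only [wp, NExp.eval, L, I₀]
    refine ⟨k, hk, hk', ⟨⟨⟨?_, h2, h3, h4⟩, h5⟩, ?_, ?_, ?_⟩, ?_⟩ <;> simp [h1, h6]
  have h6 : ∀ s', (∃ k ≤ N, (∀ i < N, s.narr 3 i ≠ k) ∧ L k s' ∧ s'.nreg 4 = 0) →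
      Runs (.loop (.nlt (.reg 4) (.reg 0)) outBody) s' (30 * N + 4) fun s' => ∃ k ≤ N,
        (∀ i < N, s.narr 3 i ≠ k) ∧
        ∀ i < N, s'.narr 2 i = if k < s.narr 3 i ∧ ¬ r₀ i < r₁ i then 0 else 1 := by
    rintro s' ⟨k, hk, hk', hL, h0⟩
    refine (Runs.loop (L k) (fun s' => N - s'.nreg 4) outBody.bound ?_ hL).mono ?_ ?_
    · rintro s' ⟨⟨⟨h1, h2, h3, h4⟩, h5⟩, h6, h7, h8⟩ ht
      refine Runs.of_wp ?_
      simp only [Test.holds, NExp.eval, h1] at ht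
      have hout : ∀ c, (c = if k < s.narr 3 (s'.nreg 4) ∧ ¬ r₀ (s'.nreg 4) < r₁ (s'.nreg 4) then 0
          else 1) → ∀ i < s'.nreg 4 + 1, Function.update (s'.narr 2) (s'.nreg 4) c i =
            if k < s.narr 3 i ∧ ¬ r₀ i < r₁ i then 0 else 1 := by
        intro c hc i hi
        rcases eq_or_ne i (s'.nreg 4) with rfl | hne
        · simpa using hc
        · rw [Function.update_of_ne hne]; exact h8 i (by omega)
      have hb : (Test.and (.nlt (.reg 5) (.get 3 (.reg 4)))
          (.not (.rlt (.get 0 (.reg 4)) (.get 1 (.reg 4))))).holds s' ↔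
          k < s.narr 3 (s'.nreg 4) ∧ ¬ r₀ (s'.nreg 4) < r₁ (s'.nreg 4) := by
        simp only [Test.holds, NExp.eval, RExp.eval, h3, h4, h5, h6]
      refine ⟨fun ht' => ?_, fun ht' => ?_⟩
      on_goal 1 => have h9 := hout 0 (if_pos (hb.1 ht')).symm
      on_goal 2 => have h9 := hout 1 (if_neg (mt hb.2 ht')).symm
      all_goals
        simp only [wp, NExp.eval, L, I₀]
        refine ⟨⟨⟨⟨?_, ?_, ?_, ?_⟩, ?_⟩, ?_, ?_, ?_⟩, ?_⟩
        · simpa using h1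
        · simpa using h2
        · simpa using h3
        · simpa using h4
        · simpa using h5
        · simpa using h6
        · simpa using ht
        · simpa using h9
        · simp; omega
    · simp only [h0]
      have : outBody.bound = 22 := by decide
      simp only [this, Test.cost, NExp.cost]; omega
    · rintro s' ⟨⟨⟨hD, -⟩, -, h7, h8⟩, ht⟩
      refine ⟨k, hk, hk', ?_⟩
      simp only [Test.holds, NExp.eval, hD.size, not_lt] at ht
      rwa [le_antisymm h7 ht] at h8
  exact (h1.seq fun s hs => (h2 s hs).seq fun s hs => (h3 s hs).seq fun s hs =>
    (h4 s hs).seq fun s hs => (h5 s hs).seq h6).mono (by omega) fun s hs => hs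

/-- The program that solves the closure problem. -/
def closureProg : Prog := .seq initProg (.seq mainLoop finishProg)

/-- The program writes an optimal closed set (restricted to the nodes that prefer the first
period) in cubic time. -/
theorem runs_closureProg {s : Store} (hN : 1 ≤ N) (hs : Start N A r₀ r₁ s) :
    Runs closureProg s (5000 * N ^ 3) fun s' => ∃ S ⊆ Finset.range N,
      (∀ i ∈ S, ∀ j < N, arc N A r₀ r₁ i j → j ∈ S) ∧
      (∀ S' ⊆ Finset.range N, (∀ i ∈ S', ∀ j < N, arc N A r₀ r₁ i j → j ∈ S') →
        ∑ i ∈ S', (r₀ i - r₁ i) ≤ ∑ i ∈ S, (r₀ i - r₁ i)) ∧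
      ∀ i < N, s'.narr 2 i = if i ∈ S ∧ ¬ r₀ i < r₁ i then 0 else 1 := by
  refine ((runs_initProg hs).seq fun s ⟨hs, hu, hB, hh, hc⟩ =>
    (runs_mainLoop hN hs hu hB hh hc).seq (b' := 80 * N + 80) fun s ⟨hs, hB⟩ =>
      (runs_finishProg hs).mono le_rfl ?_).mono ?_ fun s hs => hs
  · rintro s' ⟨k, hk, hgap, hout⟩
    have hinv := hs.inv
    rw [hB] at hinv
    refine ⟨above N (s.narr 3) k, Finset.filter_subset _ _, above_closed hinv hgap,
      fun S' hS' hc' => weight_le_above hinv hk hgap hS' hc', fun i hi => ?_⟩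
    rw [hout i hi]
    simp [above, hi]
  · have h1 : N ≤ N ^ 3 := Nat.le_self_pow (by norm_num) N
    omega

end

end Closure

/-! ## The robust optimization problem and the integer problem -/

namespace OptStop

section

variable {T N d : ℕ} {g : WithTop (Fin T) → (Fin T → Fin d → ℝ) → ℝ}
  {x : Fin N → Fin T → Fin d → ℝ} {ε : ℝ}

theorem mem_U_self (hε : 0 ≤ ε) (i : Fin N) (t : Fin T) : x i t ∈ U x ε i t := by
  simpa [U] using hε

theorem measurable_policy (σ : Fin N → Fin T) (t : Fin T) : Measurable (policy x ε σ t) := by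
  refine measurable_to_bool ?_
  have : policy x ε σ t ⁻¹' {true} = ⋃ i : Fin N, ⋃ _ : σ i = t, U x ε i t := by
    ext y; simp [policy]
  rw [this]
  refine MeasurableSet.iUnion fun i => MeasurableSet.iUnion fun _ => ?_
  exact (isClosed_le (by fun_prop) continuous_const).measurableSet

theorem stopTime_eq_coe {μ : Fin T → (Fin d → ℝ) → Bool} {y : Fin T → Fin d → ℝ} {t : Fin T} :
    stopTime μ y = t ↔ μ t (y t) = true ∧ ∀ s < t, μ s (y s) = false := by
  constructor
  · intro h
    have h1 := Finset.mem_of_min h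
    refine ⟨by simpa using h1, fun s hs => ?_⟩
    by_contra hne
    have h2 : s ∈ Finset.univ.filter fun t => μ t (y t) = true := by simpa using hne
    exact absurd (Finset.min_le_of_eq h2 h) hs.not_ge
  · rintro ⟨h1, h2⟩
    refine le_antisymm (Finset.min_le (by simpa using h1)) (Finset.le_min fun s hs => ?_)
    rw [Finset.mem_filter] at hs
    refine WithTop.coe_le_coe.2 (not_lt.1 fun hlt => ?_)
    simpa [hs.2] using h2 s hlt

theorem stopTime_eq_top {μ : Fin T → (Fin d → ℝ) → Bool} {y : Fin T → Fin d → ℝ}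
    (h : ∀ t, μ t (y t) = false) : stopTime μ y = ⊤ := by
  simp [stopTime, h]

/-- The rewards over which the integer problem takes the minimum for path `i`. -/
def rewards (g : WithTop (Fin T) → (Fin T → Fin d → ℝ) → ℝ) (x : Fin N → Fin T → Fin d → ℝ)
    (ε : ℝ) (σ : Fin N → Fin T) (i : Fin N) : Set ℝ :=
  {r : ℝ | ∃ t : Fin T, t ≤ σ i ∧ (∃ j, (U x ε i t ∩ U x ε j t).Nonempty ∧ σ j = t) ∧
    r = g t (x i)}

theorem ipObj_eq (σ : Fin N → Fin T) :
    ipObj g x ε σ = (1 / (N : ℝ)) * ∑ i, sInf (rewards g x ε σ i) := rfl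

theorem ipObj_le_roObj_policy (hε : 0 ≤ ε) (hg : ∀ t y, 0 ≤ g t y) (σ : Fin N → Fin T) :
    ipObj g x ε σ ≤ roObj g x ε (policy x ε σ) := by
  rw [ipObj_eq]
  refine mul_le_mul_of_nonneg_left (Finset.sum_le_sum fun i _ => ?_) (by positivity)
  have : Nonempty {y : Fin T → Fin d → ℝ // ∀ t, y t ∈ U x ε i t} :=
    ⟨⟨x i, fun t => mem_U_self hε i t⟩⟩
  refine le_ciInf fun y => csInf_le ⟨0, ?_⟩ ?_
  · rintro r ⟨t, -, -, rfl⟩; exact hg _ _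
  · have hi : policy x ε σ (σ i) (y.1 (σ i)) = true := by
      simpa [policy] using ⟨i, rfl, y.2 (σ i)⟩
    obtain ⟨t, ht⟩ : ∃ t : Fin T, stopTime (policy x ε σ) y.1 = t := by
      refine (Finset.min_of_nonempty ⟨σ i, ?_⟩)
      simpa using hi
    obtain ⟨h1, h2⟩ := stopTime_eq_coe.1 ht
    obtain ⟨j, hj, hyj⟩ : ∃ j, σ j = t ∧ y.1 t ∈ U x ε j t := by simpa [policy] using h1
    refine ⟨t, not_lt.1 fun hlt => ?_, ⟨j, ⟨y.1 t, y.2 t, hyj⟩, hj⟩, by rw [ht]⟩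
    simpa [hi] using h2 _ hlt

end

section

variable {T N d : ℕ} {g : WithTop (Fin (T + 1)) → (Fin (T + 1) → Fin d → ℝ) → ℝ}
  {x : Fin N → Fin (T + 1) → Fin d → ℝ} {ε : ℝ}

/-- For every exercise policies there is a solution of the integer problem that is at least as
good. -/
theorem exists_roObj_le_ipObj (hε : 0 ≤ ε) (hg : ∀ t y, 0 ≤ g t y) (hg' : ∀ y, g ⊤ y = 0)
    (μ : Fin (T + 1) → (Fin d → ℝ) → Bool) : ∃ σ, roObj g x ε μ ≤ ipObj g x ε σ := by
  classical
  let stops : Fin N → Fin (T + 1) → Prop := fun i t => ∀ y ∈ U x ε i t, μ t y = true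
  have hσ : ∀ i, ∃ t, (stops i t ∨ t = Fin.last T ∧ ∀ s, ¬ stops i s) ∧ ∀ s < t, ¬ stops i s := by
    intro i
    by_cases h : ∃ t, stops i t
    · obtain ⟨t, ht, hmin⟩ := WellFounded.has_min wellFounded_lt {t | stops i t} h
      exact ⟨t, .inl ht, fun s hs hs' => hmin s hs' hs⟩
    · push Not at h
      exact ⟨Fin.last T, .inr ⟨rfl, h⟩, fun s _ => h s⟩
  choose σ hσ hlt using hσ
  refine ⟨σ, ?_⟩
  rw [ipObj_eq]
  refine mul_le_mul_of_nonneg_left (Finset.sum_le_sum fun i _ => ?_) (by positivity)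
  have hbdd : BddBelow (Set.range fun y : {y : Fin (T + 1) → Fin d → ℝ // ∀ t, y t ∈ U x ε i t} =>
      g (stopTime μ y.1) (x i)) := ⟨0, by rintro _ ⟨y, rfl⟩; exact hg _ _⟩
  have hne : (rewards g x ε σ i).Nonempty :=
    ⟨_, σ i, le_rfl, ⟨i, ⟨x i (σ i), mem_U_self hε i _, mem_U_self hε i _⟩, rfl⟩, rfl⟩
  have hcont : ∀ t, ¬ stops i t → ∃ y ∈ U x ε i t, μ t y = false := by
    intro t ht
    simp only [stops] at ht
    push Not at ht
    simpa using ht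
  refine le_csInf hne ?_
  rintro _ ⟨t, hti, ⟨j, ⟨z, hzi, hzj⟩, rfl⟩, rfl⟩
  rcases hσ i with hi | ⟨-, hi⟩
  -- If `j` has no sure stop, then `σ j` is the last period and equals `σ i`; the sure stop of `i`
  -- then supplies the point.
  · have hexists : ∃ z ∈ U x ε i (σ j), μ (σ j) z = true := by
      rcases hσ j with hj | ⟨hj, -⟩
      · exact ⟨z, hzi, hj z hzj⟩
      · have : σ i = σ j := le_antisymm (hj ▸ Fin.le_last _) hti
        rw [← this]
        exact ⟨x i (σ i), mem_U_self hε i _, hi _ (mem_U_self hε i _)⟩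
    obtain ⟨z, hzi, hz⟩ := hexists
    -- The adversarial path: continue before `σ j`, stop at `σ j`; what comes later is irrelevant.
    have hy : ∀ s, ∃ y ∈ U x ε i s, (s < σ j → μ s y = false) ∧ (s = σ j → μ s y = true) := by
      intro s
      rcases lt_trichotomy s (σ j) with hs | rfl | hs
      · obtain ⟨y, hy, hy'⟩ := hcont s (hlt i s (hs.trans_le hti))
        exact ⟨y, hy, fun _ => hy', fun h => absurd h hs.ne⟩
      · exact ⟨z, hzi, fun h => absurd h (lt_irrefl _), fun _ => hz⟩
      · exact ⟨x i s, mem_U_self hε i s, fun h => absurd h hs.not_gt, fun h => absurd h hs.ne'⟩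
    choose y hyU hy1 hy2 using hy
    have : stopTime μ y = (σ j : WithTop (Fin (T + 1))) :=
      stopTime_eq_coe.2 ⟨hy2 _ rfl, fun s hs => hy1 s hs⟩
    rw [← this]
    exact ciInf_le hbdd ⟨y, hyU⟩
  -- Without a sure stop the adversary avoids stopping in every period, and the reward is `0`.
  · choose y hyU hy using fun s => hcont s (hi s)
    refine (ciInf_le hbdd ⟨y, hyU⟩).trans ?_
    simp only [stopTime_eq_top hy, hg']
    exact hg _ _

/-- The exercise policies generated by an optimal solution of the integer problem are optimal. -/
theorem IsOptimalIP.isOptimalRO {σ : Fin N → Fin (T + 1)} (h : IsOptimalIP g x ε σ) (hε : 0 ≤ ε)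
    (hg : ∀ t y, 0 ≤ g t y) (hg' : ∀ y, g ⊤ y = 0) : IsOptimalRO g x ε (policy x ε σ) := by
  refine ⟨measurable_policy σ, fun μ' _ => ?_⟩
  obtain ⟨σ', hσ'⟩ := exists_roObj_le_ipObj (x := x) hε hg hg' μ'
  exact (hσ'.trans (h σ')).trans (ipObj_le_roObj_policy hε hg σ)

end

/-! ### Two periods -/

section

variable {N d : ℕ} {g : WithTop (Fin 2) → (Fin 2 → Fin d → ℝ) → ℝ}
  {x : Fin N → Fin 2 → Fin d → ℝ} {ε : ℝ}

/-- The uncertainty sets of the paths `i` and `j` in the first period intersect. -/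
def Adj (x : Fin N → Fin 2 → Fin d → ℝ) (ε : ℝ) (i j : Fin N) : Prop :=
  (U x ε i 0 ∩ U x ε j 0).Nonempty

theorem Adj.symm {i j : Fin N} (h : Adj x ε i j) : Adj x ε j i := by
  rwa [Adj, Set.inter_comm]

theorem fin_two_eq_one {t : Fin 2} (h : t ≠ 0) : t = 1 := by omega

theorem sInf_rewards_zero (hε : 0 ≤ ε) {σ : Fin N → Fin 2} {i : Fin N} (h : σ i = 0) :
    sInf (rewards g x ε σ i) = g (0 : Fin 2) (x i) := by
  have : rewards g x ε σ i = {g (0 : Fin 2) (x i)} := by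
    ext r
    simp only [rewards, h, Set.mem_ofPred_eq, Set.mem_singleton_iff]
    constructor
    · rintro ⟨t, ht, -, rfl⟩
      rw [Fin.le_zero_iff.1 ht]
    · rintro rfl
      exact ⟨0, le_rfl, ⟨i, ⟨x i 0, mem_U_self hε i _, mem_U_self hε i _⟩, h⟩, rfl⟩
  rw [this, csInf_singleton]

/-- For `σ i = 1` the second period is always admitted, with `j = i` as witness. Hence only
first-period intersections matter. -/
theorem sInf_rewards_one (hε : 0 ≤ ε) {σ : Fin N → Fin 2} {i : Fin N} (h : σ i = 1)
    (h' : ¬ ∃ j, Adj x ε i j ∧ σ j = 0) :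
    sInf (rewards g x ε σ i) = g (1 : Fin 2) (x i) := by
  have : rewards g x ε σ i = {g (1 : Fin 2) (x i)} := by
    ext r
    simp only [rewards, h, Set.mem_ofPred_eq, Set.mem_singleton_iff]
    constructor
    · rintro ⟨t, -, hj, rfl⟩
      rw [fin_two_eq_one (t := t) (by rintro rfl; exact h' hj)]
    · rintro rfl
      exact ⟨1, le_rfl, ⟨i, ⟨x i 1, mem_U_self hε i _, mem_U_self hε i _⟩, h⟩, rfl⟩
  rw [this, csInf_singleton]

theorem sInf_rewards_min (hε : 0 ≤ ε) {σ : Fin N → Fin 2} {i : Fin N} (h : σ i = 1)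
    (h' : ∃ j, Adj x ε i j ∧ σ j = 0) :
    sInf (rewards g x ε σ i) = min (g (0 : Fin 2) (x i)) (g (1 : Fin 2) (x i)) := by
  have : rewards g x ε σ i = {g (0 : Fin 2) (x i), g (1 : Fin 2) (x i)} := by
    ext r
    simp only [rewards, h, Set.mem_ofPred_eq, Set.mem_singleton_iff, Set.mem_insert_iff]
    constructor
    · rintro ⟨t, -, -, rfl⟩
      by_cases ht : t = 0
      · left; rw [ht]
      · right; rw [fin_two_eq_one ht]
    · rintro (rfl | rfl)
      · exact ⟨0, by simp, h', rfl⟩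
      · exact ⟨1, le_rfl, ⟨i, ⟨x i 1, mem_U_self hε i _, mem_U_self hε i _⟩, h⟩, rfl⟩
  rw [this, csInf_pair]

open scoped Classical in
/-- A closed set of maximum weight yields an optimal solution of the integer problem. -/
theorem isOptimalIP_of_closure (hε : 0 ≤ ε) {a c : Fin N → ℝ}
    (ha : ∀ i, a i = g (0 : Fin 2) (x i)) (hc : ∀ i, c i = g (1 : Fin 2) (x i))
    {S : Finset (Fin N)} (hS : ∀ i ∈ S, ∀ j, Adj x ε i j → ¬ a i < c i → a j < c j → j ∈ S)
    (hmax : ∀ S' : Finset (Fin N),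
      (∀ i ∈ S', ∀ j, Adj x ε i j → ¬ a i < c i → a j < c j → j ∈ S') →
      ∑ i ∈ S', (a i - c i) ≤ ∑ i ∈ S, (a i - c i))
    {σ : Fin N → Fin 2} (hσ : ∀ i, σ i = if i ∈ S ∧ ¬ a i < c i then 0 else 1) :
    IsOptimalIP g x ε σ := by
  intro σ'
  rw [ipObj_eq, ipObj_eq]
  refine mul_le_mul_of_nonneg_left ?_ (by positivity)
  -- The closed set of a competitor: paths stopping first by preference, and paths preferring the
  -- second period that are exposed to a neighbour stopping first.
  let S' : Finset (Fin N) := Finset.univ.filter fun i =>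
    (σ' i = 0 ∧ ¬ a i < c i) ∨ (a i < c i ∧ ∃ j, Adj x ε i j ∧ σ' j = 0)
  have hS' : ∀ i, i ∈ S' ↔ (σ' i = 0 ∧ ¬ a i < c i) ∨
      (a i < c i ∧ ∃ j, Adj x ε i j ∧ σ' j = 0) := fun i => by simp [S']
  have hsum : ∀ R : Finset (Fin N), ∑ i, (c i + if i ∈ R then a i - c i else 0) =
      ∑ i, c i + ∑ i ∈ R, (a i - c i) := fun R => by
    rw [Finset.sum_add_distrib, Finset.sum_ite_mem, Finset.univ_inter]
  have hle : ∑ i, sInf (rewards g x ε σ' i) ≤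
      ∑ i, (c i + if i ∈ S' then a i - c i else 0) := by
    refine Finset.sum_le_sum fun i _ => ?_
    by_cases h0 : σ' i = 0
    · rw [sInf_rewards_zero hε h0, ← ha]
      by_cases hac : a i < c i
      -- Stopping first against the preference yields `a i < c i`, so membership in `S'` need not be
      -- decided.
      · split_ifs <;> linarith
      · rw [if_pos ((hS' i).2 (.inl ⟨h0, hac⟩))]; linarith
    · have h1 := fin_two_eq_one h0
      by_cases hj : ∃ j, Adj x ε i j ∧ σ' j = 0
      · rw [sInf_rewards_min hε h1 hj, ← ha, ← hc]
        by_cases hac : a i < c i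
        · rw [if_pos ((hS' i).2 (.inr ⟨hac, hj⟩)), min_eq_left hac.le]; linarith
        · rw [if_neg (mt (hS' i).1 (by tauto)), min_eq_right (not_lt.1 hac)]; linarith
      · rw [sInf_rewards_one hε h1 hj, ← hc, if_neg (mt (hS' i).1 fun h =>
          h.elim (fun h => h0 h.1) fun h => hj h.2)]; linarith
  -- Only an inequality: a path of `S` that prefers the second period still gets `c i` if no
  -- neighbour stops first.
  have hge : ∑ i, (c i + if i ∈ S then a i - c i else 0) ≤ ∑ i, sInf (rewards g x ε σ i) := by
    refine Finset.sum_le_sum fun i _ => ?_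
    have h01 : ∀ j, σ j = 0 ↔ j ∈ S ∧ ¬ a j < c j := fun j => by
      rw [hσ j]; split_ifs with h
      · exact iff_of_true rfl h
      · exact iff_of_false (by simp) h
    by_cases h0 : σ i = 0
    · rw [sInf_rewards_zero hε h0, ← ha, if_pos ((h01 i).1 h0).1]; linarith
    · have h1 := fin_two_eq_one h0
      have hi := mt (h01 i).2 h0
      by_cases hj : ∃ j, Adj x ε i j ∧ σ j = 0
      · rw [sInf_rewards_min hε h1 hj, ← ha, ← hc]
        by_cases hac : a i < c i
        · obtain ⟨j, hij, hj⟩ := hj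
          obtain ⟨hjS, hj'⟩ := (h01 j).1 hj
          -- The neighbour that stops first lies in `S`; closedness puts `i` in `S`, so its loss is
          -- already counted.
          rw [if_pos (hS j hjS i hij.symm hj' hac), min_eq_left hac.le]; linarith
        · rw [if_neg fun h => hi ⟨h, hac⟩, min_eq_right (not_lt.1 hac)]; linarith
      · rw [sInf_rewards_one hε h1 hj, ← hc]
        by_cases hiS : i ∈ S
        · have : a i < c i := not_not.1 fun h => hi ⟨hiS, h⟩
          rw [if_pos hiS]; linarith
        · rw [if_neg hiS]; linarith
  have hcl := hmax S' fun i hi j hij hai haj => (hS' j).2 (.inr ⟨haj, i, hij.symm, by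
    rcases (hS' i).1 hi with h | h
    · exact h.1
    · exact absurd h.1 hai⟩)
  rw [hsum] at hle hge
  linarith

open scoped Classical in
/-- From a store with the adjacency table and the rewards, the closure program finds an optimal
solution. -/
theorem runs_closureProg (hN : 1 ≤ N) (hε : 0 ≤ ε) (hg : ∀ t y, 0 ≤ g t y)
    (hg' : ∀ y, g ⊤ y = 0) {A : ℕ → ℕ} {r₀ r₁ : ℕ → ℝ}
    (hA : ∀ i j : Fin N, A (i * N + j) = 1 ↔ Adj x ε i j)
    (h₀ : ∀ i : Fin N, r₀ i = g (0 : Fin 2) (x i)) (h₁ : ∀ i : Fin N, r₁ i = g (1 : Fin 2) (x i))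
    {s : RealRAM.Store} (hs : Closure.Start N A r₀ r₁ s) :
    RealRAM.Runs Closure.closureProg s (5000 * N ^ 3) fun s' =>
      ∃ σ : Fin N → Fin 2, (∀ i : Fin N, s'.narr 2 (i : ℕ) = (σ i : ℕ)) ∧
        IsOptimalIP g x ε σ ∧ IsOptimalRO g x ε (policy x ε σ) := by
  refine (Closure.runs_closureProg hN hs).mono le_rfl ?_
  rintro s' ⟨S, hSN, hcl, hmax, hout⟩
  let S₁ : Finset (Fin N) := Finset.univ.filter fun i => (i : ℕ) ∈ S
  have hmem : ∀ i, i ∈ S₁ ↔ (i : ℕ) ∈ S := fun i => by simp [S₁]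
  have hS₁ : S = S₁.map Fin.valEmbedding := by
    ext i
    simp only [Finset.mem_map, hmem, Fin.valEmbedding_apply]
    exact ⟨fun hi => ⟨⟨i, Finset.mem_range.1 (hSN hi)⟩, hi, rfl⟩, by rintro ⟨j, hj, rfl⟩; exact hj⟩
  let σ : Fin N → Fin 2 := fun i => if i ∈ S₁ ∧ ¬ r₀ i < r₁ i then 0 else 1
  have hopt : IsOptimalIP g x ε σ := by
    refine isOptimalIP_of_closure hε (a := fun i => r₀ i) (c := fun i => r₁ i) h₀ h₁ (S := S₁)
      ?_ ?_ fun _ => rfl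
    · intro i hi j hij h h'
      exact (hmem j).2 (hcl i ((hmem i).1 hi) j j.2 ⟨(hA i j).2 hij, h, h'⟩)
    · intro S' hS'
      have := hmax (S'.map Fin.valEmbedding) (fun i hi => by
        obtain ⟨j, -, rfl⟩ := Finset.mem_map.1 hi
        exact Finset.mem_range.2 j.2) (fun i hi j hj hD => by
        obtain ⟨i, hi', rfl⟩ := Finset.mem_map.1 hi
        exact Finset.mem_map.2 ⟨⟨j, hj⟩, hS' i hi' ⟨j, hj⟩ ((hA i ⟨j, hj⟩).1 hD.1) hD.2.1 hD.2.2,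
          rfl⟩)
      rw [hS₁, Finset.sum_map, Finset.sum_map] at this
      exact this
  refine ⟨σ, fun i => ?_, hopt, hopt.isOptimalRO hε hg hg'⟩
  rw [hout i i.2]
  simp only [σ, hmem]
  split_ifs <;> rfl

end

end OptStop

/-! ## The adjacency table from the sample paths

Natural registers: `4`, `5` the paths, `6` the coordinate, `7`, `8` the offsets of the rows of the
two paths in the matrix of states, `9` the address in the table. -/

namespace RealRAM

theorem vec_apply {α : Type} [Zero α] {m : ℕ} (f : Fin m → α) (i : Fin m) : vec f i = f i := by
  simp [vec]

theorem mat_apply {α : Type} [Zero α] {m n : ℕ} (f : Fin m → Fin n → α) (i : Fin m) (j : Fin n) :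
    mat f (i * n + j) = f i j := by
  have h : (i : ℕ) * n + j = (finProdFinEquiv (i, j) : Fin (m * n)) := by
    simp only [finProdFinEquiv_apply_val]; ring
  rw [h, mat, dif_pos (Fin.is_lt _)]
  simp only [Fin.eta, Equiv.symm_apply_apply]

end RealRAM

namespace OptStop

open RealRAM

section

variable {N d : ℕ} {x : Fin N → Fin 2 → Fin d → ℝ} {ε : ℝ}

/-- Two boxes of equal radius meet if and only if their centres differ by at most twice the radius
in each coordinate; the midpoint is a witness. The right-hand side is in the form that the machine
can test. -/
theorem adj_iff (hε : 0 ≤ ε) (i j : Fin N) : Adj x ε i j ↔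
    ∀ k, ¬ ε + ε < x i 0 k - x j 0 k ∧ ¬ ε + ε < x j 0 k - x i 0 k := by
  simp only [Adj, U, Set.Nonempty, Set.mem_inter_iff, Set.mem_ofPred_eq,
    pi_norm_le_iff_of_nonneg hε, Real.norm_eq_abs, Pi.sub_apply, abs_le, not_lt]
  constructor
  · rintro ⟨y, h1, h2⟩ k
    have := h1 k
    have := h2 k
    constructor <;> linarith
  · intro h
    refine ⟨fun k => (x i 0 k + x j 0 k) / 2, fun k => ?_, fun k => ?_⟩ <;>
    · have := h k
      constructor <;> linarith

/-- The states of the paths `i` and `j` differ by at most `2 ε` in coordinate `k`. -/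
def CloseAt (d : ℕ) (ε : ℝ) (X : ℕ → ℝ) (i j k : ℕ) : Prop :=
  ¬ ε + ε < X (i * d + k) - X (j * d + k) ∧ ¬ ε + ε < X (j * d + k) - X (i * d + k)

/-- The table is correct at all addresses below `m`. -/
def TableUpTo (N d : ℕ) (ε : ℝ) (X : ℕ → ℝ) (A : ℕ → ℕ) (m : ℕ) : Prop :=
  ∀ i j, j < N → i * N + j < m → (A (i * N + j) = 1 ↔ ∀ k < d, CloseAt d ε X i j k)

/-- Compare one coordinate. -/
def coordBody : Prog :=
  .seq (.branch
      (.and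
        (.not (.rlt (.add (.reg 0) (.reg 0))
          (.sub (.get 2 (.add (.reg 7) (.reg 6))) (.get 2 (.add (.reg 8) (.reg 6))))))
        (.not (.rlt (.add (.reg 0) (.reg 0))
          (.sub (.get 2 (.add (.reg 8) (.reg 6))) (.get 2 (.add (.reg 7) (.reg 6)))))))
      .skip (.nput 0 (.reg 9) (.num 0)))
    (.nset 6 (.add (.reg 6) (.num 1)))

/-- Compute one entry of the table. -/
def entryProg : Prog :=
  .seq (.seq (.nset 6 (.num 0)) (.nput 0 (.reg 9) (.num 1)))
    (.seq (.loop (.nlt (.reg 6) (.reg 1)) coordBody)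
      (.seq (.nset 9 (.add (.reg 9) (.num 1)))
        (.seq (.nset 8 (.add (.reg 8) (.reg 1))) (.nset 5 (.add (.reg 5) (.num 1))))))

/-- Compute one row of the table. -/
def rowProg : Prog :=
  .seq (.seq (.nset 5 (.num 0)) (.nset 8 (.num 0)))
    (.seq (.loop (.nlt (.reg 5) (.reg 0)) entryProg)
      (.seq (.nset 7 (.add (.reg 7) (.reg 1))) (.nset 4 (.add (.reg 4) (.num 1)))))

/-- Compute the table. -/
def tableProg : Prog := .loop (.nlt (.reg 4) (.reg 0)) rowProg

/-- The stores that hold the data. -/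
structure Raw (N d : ℕ) (ε : ℝ) (R : ℕ → ℕ → ℝ) (s : Store) : Prop where
  size : s.nreg 0 = N
  dim : s.nreg 1 = d
  eps : s.rreg 0 = ε
  reals : s.rarr = R
  nats : ∀ a, a ≠ 0 → s.narr a = fun _ => 0

/-- The stores between two entries of row `i` of the table. -/
structure InRow (N d : ℕ) (ε : ℝ) (R : ℕ → ℕ → ℝ) (i : ℕ) (s : Store) : Prop
    extends Raw N d ε R s where
  path : s.nreg 4 = i
  offset : s.nreg 7 = i * d
  path' : s.nreg 5 ≤ N
  offset' : s.nreg 8 = s.nreg 5 * d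
  addr : s.nreg 9 = i * N + s.nreg 5
  table : TableUpTo N d ε (R 2) (s.narr 0) (s.nreg 9)

variable {R : ℕ → ℕ → ℝ}

/-- The entry starts as `1` and is overwritten by `0` at each coordinate that fails; all `d`
coordinates are visited. -/
theorem runs_entryProg {i : ℕ} {s : Store} (hs : InRow N d ε R i s) (hj : s.nreg 5 < N) :
    Runs entryProg s (60 * d + 30) fun s' =>
      InRow N d ε R i s' ∧ N - s'.nreg 5 < N - s.nreg 5 := by
  let J : ℕ → Store → Prop := fun j s => InRow N d ε R i s ∧ s.nreg 5 = j ∧ s.nreg 6 ≤ d ∧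
    (s.narr 0 (s.nreg 9) = 1 ↔ ∀ k < s.nreg 6, CloseAt d ε (R 2) i j k)
  -- The entry in progress sits at address `m`, just beyond the finished part of the table.
  have htab : ∀ (A : ℕ → ℕ) (m c : ℕ), TableUpTo N d ε (R 2) A m →
      TableUpTo N d ε (R 2) (Function.update A m c) m := by
    intro A m c hA i' j' hj' hlt
    rw [Function.update_of_ne hlt.ne]
    exact hA i' j' hj' hlt
  have h1 : Runs (.seq (.nset 6 (.num 0)) (.nput 0 (.reg 9) (.num 1))) s 5 fun s' =>
      J (s.nreg 5) s' ∧ s'.nreg 6 = 0 := by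
    refine Runs.of_wp (P := .seq _ _) ?_
    obtain ⟨⟨h1, h2, h3, h4, h5⟩, h6, h7, h8, h9, h10, h11⟩ := hs
    simp only [wp, NExp.eval, J]
    refine ⟨⟨⟨⟨?_, ?_, h3, h4, fun a ha => ?_⟩, ?_, ?_, ?_, ?_, ?_, ?_⟩, ?_, ?_, ?_⟩, ?_⟩
    · simpa using h1
    · simpa using h2
    · simpa [ha] using h5 a ha
    · simpa using h6
    · simpa using h7
    · simpa using h8
    · simpa using h9
    · simpa using h10
    · simpa using htab _ _ 1 h11
    all_goals simp
  have h2 : ∀ s', J (s.nreg 5) s' ∧ s'.nreg 6 = 0 →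
      Runs (.loop (.nlt (.reg 6) (.reg 1)) coordBody) s' (60 * d + 4) fun s' =>
        J (s.nreg 5) s' ∧ s'.nreg 6 = d := by
    rintro s' ⟨hs', h0⟩
    refine (Runs.loop (J (s.nreg 5)) (fun s' => d - s'.nreg 6) coordBody.bound ?_ hs').mono ?_ ?_
    · rintro s' ⟨⟨⟨h1, h2, h3, h4, h5⟩, h6, h7, h8, h9, h10, h11⟩, h12, h13, h14⟩ ht
      refine Runs.of_wp ?_
      simp only [Test.holds, NExp.eval, h2] at ht
      have hstep : (∀ k < s'.nreg 6 + 1, CloseAt d ε (R 2) i (s.nreg 5) k) ↔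
          (∀ k < s'.nreg 6, CloseAt d ε (R 2) i (s.nreg 5) k) ∧
            CloseAt d ε (R 2) i (s.nreg 5) (s'.nreg 6) := by
        simp only [Nat.lt_succ_iff_lt_or_eq, or_imp, forall_and, forall_eq]
      refine ⟨fun hb => ?_, fun hb => ?_⟩ <;>
        simp only [Test.holds, NExp.eval, RExp.eval, h3, h4, h7, h9, h12] at hb
      · have hb' : CloseAt d ε (R 2) i (s.nreg 5) (s'.nreg 6) := hb
        simp only [wp, NExp.eval, J]
        refine ⟨⟨⟨⟨?_, ?_, h3, h4, h5⟩, ?_, ?_, ?_, ?_, ?_, ?_⟩, ?_, ?_, ?_⟩, ?_⟩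
        · simpa using h1
        · simpa using h2
        · simpa using h6
        · simpa using h7
        · simpa using h8
        · simpa using h9
        · simpa using h10
        · simpa using h11
        · simpa using h12
        · simpa using ht
        · simpa [hb', h14] using hstep.symm
        · simp; omega
      · have hb' : ¬ CloseAt d ε (R 2) i (s.nreg 5) (s'.nreg 6) := hb
        simp only [wp, NExp.eval, J]
        refine ⟨⟨⟨⟨?_, ?_, h3, h4, fun a ha => ?_⟩, ?_, ?_, ?_, ?_, ?_, ?_⟩, ?_, ?_, ?_⟩, ?_⟩
        · simpa using h1
        · simpa using h2
        · simpa [ha] using h5 a ha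
        · simpa using h6
        · simpa using h7
        · simpa using h8
        · simpa using h9
        · simpa using h10
        · simpa using htab _ _ 0 h11
        · simpa using h12
        · simpa using ht
        · simpa [hb'] using mt hstep.1
        · simp; omega
    · have : coordBody.bound = 38 := by decide
      simp only [this, h0, Test.cost, NExp.cost]; omega
    · rintro s' ⟨hJ, ht⟩
      refine ⟨hJ, ?_⟩
      simp only [Test.holds, NExp.eval, hJ.1.dim] at ht
      exact le_antisymm hJ.2.2.1 (not_lt.1 ht)
  have h3 : ∀ s', J (s.nreg 5) s' ∧ s'.nreg 6 = d →
      Runs (.seq (.nset 9 (.add (.reg 9) (.num 1)))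
        (.seq (.nset 8 (.add (.reg 8) (.reg 1))) (.nset 5 (.add (.reg 5) (.num 1))))) s' 12
        fun s' => InRow N d ε R i s' ∧ N - s'.nreg 5 < N - s.nreg 5 := by
    rintro s' ⟨⟨⟨⟨h1, h2, h3, h4, h5⟩, h6, h7, h8, h9, h10, h11⟩, h12, h13, h14⟩, h15⟩
    refine Runs.of_wp (P := .seq _ _) ?_
    simp only [wp, NExp.eval]
    refine ⟨⟨⟨?_, ?_, h3, h4, h5⟩, ?_, ?_, ?_, ?_, ?_, ?_⟩, ?_⟩
    · simpa using h1
    · simpa using h2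
    · simpa using h6
    · simpa using h7
    · simpa [h12] using hj
    · simp [h2, h9, add_mul]
    · simp [h10, add_assoc]
    · have h16 : TableUpTo N d ε (R 2) (s'.narr 0) (s'.nreg 9 + 1) := ?_
      · simpa using h16
      intro i' j' hj' hlt
      rcases Nat.lt_succ_iff_lt_or_eq.1 hlt with hlt | heq
      · exact h11 i' j' hj' hlt
      · obtain ⟨rfl, rfl⟩ := (Closure.address_inj hj' (h12 ▸ hj)).1 (heq.trans h10)
        rw [heq, h14, h15, h12]
    · simp [h12]; omega
  exact (h1.seq fun s hs => (h2 s hs).seq h3).mono (by omega) fun s hs => hs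

/-- The stores between two rows of the table. -/
structure BetweenRows (N d : ℕ) (ε : ℝ) (R : ℕ → ℕ → ℝ) (s : Store) : Prop
    extends Raw N d ε R s where
  path : s.nreg 4 ≤ N
  offset : s.nreg 7 = s.nreg 4 * d
  addr : s.nreg 9 = s.nreg 4 * N
  table : TableUpTo N d ε (R 2) (s.narr 0) (s.nreg 9)

theorem runs_rowProg {s : Store} (hs : BetweenRows N d ε R s) (hi : s.nreg 4 < N) :
    Runs rowProg s ((60 * d + 40) * N + 20) fun s' =>
      BetweenRows N d ε R s' ∧ N - s'.nreg 4 < N - s.nreg 4 := by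
  have h1 : Runs (.seq (.nset 5 (.num 0)) (.nset 8 (.num 0))) s 4 fun s' =>
      InRow N d ε R (s.nreg 4) s' ∧ s'.nreg 5 = 0 := by
    refine Runs.of_wp (P := .seq _ _) ?_
    obtain ⟨⟨h1, h2, h3, h4, h5⟩, h6, h7, h8, h9⟩ := hs
    simp only [wp, NExp.eval]
    refine ⟨⟨⟨?_, ?_, h3, h4, h5⟩, ?_, ?_, ?_, ?_, ?_, ?_⟩, ?_⟩
    · simpa using h1
    · simpa using h2
    · simp
    · simpa using h7
    · simp
    · simp
    · simpa using h8
    · simpa using h9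
    · simp
  have h2 : ∀ s', InRow N d ε R (s.nreg 4) s' ∧ s'.nreg 5 = 0 →
      Runs (.loop (.nlt (.reg 5) (.reg 0)) entryProg) s' ((60 * d + 34) * N + 4) fun s' =>
        InRow N d ε R (s.nreg 4) s' ∧ s'.nreg 5 = N := by
    rintro s' ⟨hs', h0⟩
    refine (Runs.loop (InRow N d ε R (s.nreg 4)) (fun s' => N - s'.nreg 5) (60 * d + 30)
      (fun s' hs' ht => runs_entryProg hs' ?_) hs').mono ?_ ?_
    · simpa only [Test.holds, NExp.eval, hs'.size] using ht
    · simp only [h0, Test.cost, NExp.cost, Nat.sub_zero]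
      refine Nat.add_le_add (Nat.mul_le_mul_right _ (by omega)) (by omega)
    · rintro s' ⟨hI, ht⟩
      refine ⟨hI, ?_⟩
      simp only [Test.holds, NExp.eval, hI.size] at ht
      exact le_antisymm hI.path' (not_lt.1 ht)
  have h3 : ∀ s', InRow N d ε R (s.nreg 4) s' ∧ s'.nreg 5 = N →
      Runs (.seq (.nset 7 (.add (.reg 7) (.reg 1))) (.nset 4 (.add (.reg 4) (.num 1)))) s' 8
        fun s' => BetweenRows N d ε R s' ∧ N - s'.nreg 4 < N - s.nreg 4 := by
    rintro s' ⟨⟨⟨h1, h2, h3, h4, h5⟩, h6, h7, h8, h9, h10, h11⟩, h12⟩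
    refine Runs.of_wp (P := .seq _ _) ?_
    simp only [wp, NExp.eval]
    refine ⟨⟨⟨?_, ?_, h3, h4, h5⟩, ?_, ?_, ?_, ?_⟩, ?_⟩
    · simpa using h1
    · simpa using h2
    · simpa [h6] using hi
    · simp [h6, h7, h2, add_mul]
    · simp [h6, h10, h12, add_mul]
    · simpa using h11
    · simp [h6]; omega
  refine (h1.seq fun s hs => (h2 s hs).seq h3).mono ?_ fun s hs => hs
  have : (60 * d + 34) * N ≤ (60 * d + 40) * N := Nat.mul_le_mul_right _ (by omega)
  omega

theorem runs_tableProg {s : Store} (hs : Raw N d ε R s) (h4 : s.nreg 4 = 0) (h7 : s.nreg 7 = 0)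
    (h9 : s.nreg 9 = 0) :
    Runs tableProg s (((60 * d + 40) * N + 24) * N + 4) fun s' =>
      Raw N d ε R s' ∧ TableUpTo N d ε (R 2) (s'.narr 0) (N * N) := by
  have hs' : BetweenRows N d ε R s :=
    ⟨hs, by omega, by simp [h4, h7], by simp [h4, h9], by intro i j; omega⟩
  refine (Runs.loop (BetweenRows N d ε R) (fun s' => N - s'.nreg 4) ((60 * d + 40) * N + 20)
      (fun s' hs' ht => runs_rowProg hs' ?_) hs').mono ?_ ?_
  · simpa only [Test.holds, NExp.eval, hs'.size] using ht
  · simp only [h4, Test.cost, NExp.cost, Nat.sub_zero]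
    refine Nat.add_le_add (Nat.mul_le_mul_right _ (by omega)) (by omega)
  · rintro s' ⟨hI, ht⟩
    refine ⟨hI.toRaw, ?_⟩
    simp only [Test.holds, NExp.eval, hI.size] at ht
    have := hI.table
    rwa [hI.addr, le_antisymm hI.path (not_lt.1 ht)] at this

end

/-! ### The two input formats -/

section

variable {N d : ℕ} {x : Fin N → Fin 2 → Fin d → ℝ} {ε : ℝ}
  {g : WithTop (Fin 2) → (Fin 2 → Fin d → ℝ) → ℝ}

theorem start_tableInput : Closure.Start N ((tableInput g x ε).narr 0) ((tableInput g x ε).rarr 0)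
    ((tableInput g x ε).rarr 1) (tableInput g x ε) := by
  refine ⟨⟨?_, rfl, rfl, rfl⟩, ?_, ?_, ?_, ?_⟩ <;> simp [tableInput]

theorem solvesWithin_tableInput (hN : 1 ≤ N) (hε : 0 ≤ ε) (hg : ∀ t y, 0 ≤ g t y)
    (hg' : ∀ y, g ⊤ y = 0) :
    SolvesWithin Closure.closureProg (tableInput g x ε) (5000 * N ^ 3) g x ε := by
  obtain ⟨s', n, h⟩ := runs_closureProg hN hε hg hg' (A := (tableInput g x ε).narr 0)
    (fun i j => by
      simp only [tableInput, Nat.ofNat_pos, dite_true, mat_apply, Adj]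
      split_ifs with h
      · exact iff_of_true rfl h
      · exact iff_of_false (by simp) h)
    (fun i => by simp [tableInput, vec_apply]) (fun i => by simp [tableInput, vec_apply])
    start_tableInput
  exact ⟨s', n, h⟩

/-- The table program writes no array but natural array `0`, so the others are still zero as
`Closure.Start` demands. The values left in scratch registers do no harm, since `Closure.Start`
fixes only register `0`. -/
theorem solvesWithin_rawInput (hN : 1 ≤ N) (hε : 0 ≤ ε) (hg : ∀ t y, 0 ≤ g t y)
    (hg' : ∀ y, g ⊤ y = 0) :
    SolvesWithin (.seq tableProg Closure.closureProg) (rawInput g x ε)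
      (6000 * (N ^ 3 + N ^ 2 * d)) g x ε := by
  have hraw : Raw N d ε (rawInput g x ε).rarr (rawInput g x ε) := by
    constructor <;> simp [rawInput]
  have hrun := (runs_tableProg hraw (by simp [rawInput]) (by simp [rawInput])
    (by simp [rawInput])).seq fun s ⟨hs, hT⟩ =>
      runs_closureProg (x := x) hN hε hg hg' (A := s.narr 0) (r₀ := s.rarr 0) (r₁ := s.rarr 1)
        (fun i j => ?_) (fun i => ?_) (fun i => ?_)
        ⟨⟨hs.size, rfl, rfl, rfl⟩, hs.nats 3 (by simp), hs.nats 4 (by simp), hs.nats 6 (by simp),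
          ?_⟩
  · obtain ⟨s', n, he, hn, h⟩ := hrun
    refine ⟨s', n, he, hn.trans ?_, h⟩
    have h1 : N ^ 2 ≤ N ^ 3 := Nat.pow_le_pow_right hN (by norm_num)
    have h2 : N ≤ N ^ 3 := Nat.le_self_pow (by norm_num) N
    have h3 : ((60 * d + 40) * N + 24) * N = 60 * (N ^ 2 * d) + 40 * N ^ 2 + 24 * N := by ring
    omega
  · have hlt : (i : ℕ) * N + j < N * N := by
      have := Nat.mul_le_mul_right N (Nat.succ_le_of_lt i.2)
      have := j.2
      rw [Nat.succ_mul] at *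
      omega
    rw [hT i j j.2 hlt, adj_iff hε]
    constructor
    · intro h k
      simpa [CloseAt, rawInput, mat_apply] using h k k.2
    · intro h k hk
      simpa [CloseAt, rawInput, mat_apply (fun (i : Fin N) (k : Fin d) => x i 0 k) _ ⟨k, hk⟩]
        using h ⟨k, hk⟩
  · rw [hs.reals]; simp [rawInput, vec_apply]
  · rw [hs.reals]; simp [rawInput, vec_apply]
  · rw [hs.reals]; simp [rawInput]

end

end OptStop

theorem theorem6 :
    (∃ (P : RealRAM.Prog) (C : ℕ), ∀ (N d : ℕ) (x : Fin N → Fin 2 → Fin d → ℝ) (ε : ℝ)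
      (g : WithTop (Fin 2) → (Fin 2 → Fin d → ℝ) → ℝ),
      1 ≤ N → 0 ≤ ε → (∀ t y, 0 ≤ g t y) → (∀ y, g ⊤ y = 0) →
      OptStop.SolvesWithin P (OptStop.tableInput g x ε) (C * N ^ 3) g x ε) ∧
    (∃ (P : RealRAM.Prog) (C : ℕ), ∀ (N d : ℕ) (x : Fin N → Fin 2 → Fin d → ℝ) (ε : ℝ)
      (g : WithTop (Fin 2) → (Fin 2 → Fin d → ℝ) → ℝ),
      1 ≤ N → 0 ≤ ε → (∀ t y, 0 ≤ g t y) → (∀ y, g ⊤ y = 0) →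
      OptStop.SolvesWithin P (OptStop.rawInput g x ε) (C * (N ^ 3 + N ^ 2 * d)) g x ε) := by
  exact ⟨⟨Closure.closureProg, 5000, fun _ _ _ _ _ hN hε hg hg' =>
      OptStop.solvesWithin_tableInput hN hε hg hg'⟩,
    ⟨.seq OptStop.tableProg Closure.closureProg, 6000, fun _ _ _ _ _ hN hε hg hg' =>
      OptStop.solvesWithin_rawInput hN hε hg hg'⟩⟩
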